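/- Let $K=\{1,\dots,k\}$ be a finite set of agents and $V$ a set of $n$ items. Each agent $i\in K$ has a preference graph $G_i=(V_i,A_i)$, a directed acyclic graph with $V_i\subseteq V$. For $u,v\in V_i$, item $u$ is dominated by $v$ (for agent $i$) if $u=v$ or there is a directed path from $v$ to $u$ in $G_i$. An allocation is a map $\pi:K\to 2^V$ with pairwise disjoint values (items may remain unassigned). The dissatisfaction $\delta_\pi(i)$ is the number of items in $V_i$ that are not dominated by any item of $\pi(i)$. Given $K$, $V$, $(G_i)_{i\in K}$ and an integer $d$, Min-Max Dissatisfaction asks whether some allocation $\pi$ satisfies $\delta_\pi(i)\le d$ for every $i\in K$, and Min-Sum Dissatisfaction asks whether some allocation $\pi$ satisfies $\sum_{i\in K}\delta_\pi(i)\le d$. **Theorem.** Restricted to instances in which every $G_i$ is a single directed path $v_0\to v_1\to\cdots\to v_\ell$ ($\ell\ge 0$, pairwise distinct vertices, where $\ell$ and the vertices may depend on $i$, and where $V_i$ need not be all of $V$), Min-Max Dissatisfaction and Min-Sum Dissatisfaction can both be solved in polynomial time in the size of the input. This holds for the decision problems as well as for the optimization problems: on such instances, an allocation minimizing $\max_{i\in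 K}\delta_\pi(i)$, and an allocation minimizing $\sum_{i\in K}\delta_\pi(i)$, can each be computed in polynomial time. (Graphs are given by vertex-membership bits and adjacency matrices, and $d$ in binary; the running time is the number of steps of a random access machine with addition and subtraction at unit cost, a model polynomially equivalent to Turing machines.) -/

import Mathlib

/-! ### Preference graphs, allocations, dissatisfaction -/

namespace Dissat

/-- A directed acyclic graph whose vertex set is a subset of the item set `Fin n`. -/
structure PrefGraph (n : ℕ) where
  verts : Finset (Fin n)
  arcs : Finset (Fin n × Fin n)
  arcs_mem : ∀ a ∈ arcs, a.1 ∈ verts ∧ a.2 ∈ verts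
  /-- there is no closed walk of positive length -/
  acyclic : ∀ v, ¬ Relation.TransGen (fun x y => (x, y) ∈ arcs) v v

namespace PrefGraph

variable {n : ℕ}

/-- The graph is a path `v₀ → v₁ → ⋯ → v_ℓ` with `ℓ ≥ 0` and pairwise distinct vertices: these are
all its vertices, and the arcs `(v_j, v_{j+1})` are all its arcs. -/
def IsPath (G : PrefGraph n) : Prop :=
  ∃ (ℓ : ℕ) (p : Fin (ℓ + 1) → Fin n), Function.Injective p ∧
    G.verts = Finset.univ.image p ∧
    G.arcs = Finset.univ.image (fun j : Fin ℓ => (p j.castSucc, p j.succ))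

/-- The set of predecessors of `v`: the vertices `u ≠ v` from which `v` can be reached. -/
def pred (G : PrefGraph n) (v : Fin n) : Set (Fin n) :=
  {u | u ∈ G.verts ∧ u ≠ v ∧ Relation.ReflTransGen (fun x y => (x, y) ∈ G.arcs) u v}

/-- Item `u` is dominated by item `v` (both in the graph): `u = v` or `v` is a predecessor
of `u`. -/
def IsDominatedBy (G : PrefGraph n) (u v : Fin n) : Prop :=
  u ∈ G.verts ∧ v ∈ G.verts ∧ (u = v ∨ v ∈ G.pred u)

end PrefGraph

/-- The agents are `Fin k`, the items are `Fin n`, and every agent has a preference graph. -/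
structure Profile where
  k : ℕ
  n : ℕ
  graph : Fin k → PrefGraph n

namespace Profile

/-- An allocation: pairwise disjoint sets of items, one for each agent. Items may stay
unassigned. -/
structure Allocation (I : Profile) where
  bundle : Fin I.k → Finset (Fin I.n)
  disjoint : ∀ i j, i ≠ j → Disjoint (bundle i) (bundle j)

open Classical in
/-- The dissatisfaction of agent `i`: the number of items of her preference graph that are not
dominated by any item she receives. -/
noncomputable def dissat (I : Profile) (π : I.Allocation) (i : Fin I.k) : ℕ :=
  ((I.graph i).verts.filter
    (fun u => ¬ ∃ v ∈ π.bundle i, (I.graph i).IsDominatedBy u v)).card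

/-- The maximum dissatisfaction over all agents (`0` if there are no agents). -/
noncomputable def maxDissat (I : Profile) (π : I.Allocation) : ℕ :=
  Finset.univ.sup (I.dissat π)

/-- The total dissatisfaction of all agents. -/
noncomputable def sumDissat (I : Profile) (π : I.Allocation) : ℕ :=
  ∑ i, I.dissat π i

/-- Every preference graph is a single path. -/
def AllPaths (I : Profile) : Prop := ∀ i, (I.graph i).IsPath

/-- The question of Min-Max Dissatisfaction with threshold `d`. -/
def MinMaxYes (I : Profile) (d : ℤ) : Prop :=
  ∃ π : I.Allocation, ∀ i, (I.dissat π i : ℤ) ≤ d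

/-- The question of Min-Sum Dissatisfaction with threshold `d`. -/
def MinSumYes (I : Profile) (d : ℤ) : Prop :=
  ∃ π : I.Allocation, (I.sumDissat π : ℤ) ≤ d

/-- The encoding of a profile: `k`, `n`, and then for every agent the `n` membership bits of the
vertex set followed by the `n × n` adjacency matrix, row by row. -/
def encode (I : Profile) : List ℕ :=
  [I.k, I.n] ++ (List.finRange I.k).flatMap fun i =>
    ((List.finRange I.n).map fun v => if v ∈ (I.graph i).verts then 1 else 0) ++
    (List.finRange I.n).flatMap fun u =>
      (List.finRange I.n).map fun v => if (u, v) ∈ (I.graph i).arcs then 1 else 0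

/-- The encoding of a decision instance: the threshold (sign and absolute value), then the
profile. -/
def encodeWithThreshold (x : Profile × ℤ) : List ℕ :=
  [if x.2 < 0 then 1 else 0, x.2.natAbs] ++ x.1.encode

/-- The encoding of an allocation: the `k × n` incidence matrix, row by row. -/
def Allocation.encode {I : Profile} (π : I.Allocation) : List ℕ :=
  (List.finRange I.k).flatMap fun i =>
    (List.finRange I.n).map fun v => if v ∈ π.bundle i then 1 else 0

end Profile

end Dissat

/-! ### Random access programs with a step count

Programs over natural-number variables and arrays of natural numbers with indirect addressing,
addition, truncated subtraction and no multiplication; every elementary operation costs one step.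
Since a value can at most double in one step, this is the unit-cost (addition and subtraction)
random access machine, which is polynomially equivalent to the Turing machine. -/

namespace RAM

/-- A memory state: the variables, and the cells of the arrays; a program mentions only finitely
many variables and arrays. -/
structure State where
  var : ℕ → ℕ
  arr : ℕ → ℕ → ℕ

namespace State

def setVar (s : State) (x v : ℕ) : State :=
  { s with var := Function.update s.var x v }

def setArr (s : State) (a j v : ℕ) : State :=
  { s with arr := Function.update s.arr a (Function.update (s.arr a) j v) }

/-- The start state for an input word: its length is in variable `0`, its entries are in the first
cells of array `0`, and everything else is `0`. -/
def start (w : List ℕ) : State where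
  var := fun x => if x = 0 then w.length else 0
  arr := fun a j => if a = 0 then w.getD j 0 else 0

/-- The output word: its length is read from variable `0`, its entries from array `0`. -/
def output (s : State) : List ℕ :=
  (List.range (s.var 0)).map (s.arr 0)

end State

inductive Expr where
  | const (c : ℕ)
  | var (x : ℕ)
  | read (a : ℕ) (j : Expr)
  | add (e f : Expr)
  | sub (e f : Expr)

namespace Expr

def eval (s : State) : Expr → ℕ
  | const c => c
  | var x => s.var x
  | read a j => s.arr a (j.eval s)
  | add e f => e.eval s + f.eval s
  | sub e f => e.eval s - f.eval s

/-- The number of elementary operations of an evaluation. -/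
def cost : Expr → ℕ
  | const _ => 1
  | var _ => 1
  | read _ j => j.cost + 1
  | add e f => e.cost + f.cost + 1
  | sub e f => e.cost + f.cost + 1

end Expr

inductive Prog where
  | skip
  | assign (x : ℕ) (e : Expr)
  | write (a : ℕ) (j e : Expr)
  | seq (p q : Prog)
  | cond (e : Expr) (p q : Prog)
  | loop (e : Expr) (p : Prog)

/-- `Exec p s t s'`: started in state `s`, the program `p` halts in state `s'` after exactly `t`
steps. A condition counts as true when its value is not `0`; `loop e p` repeats `p` while `e` is
true. -/
inductive Exec : Prog → State → ℕ → State → Prop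
  | skip (s : State) : Exec .skip s 1 s
  | assign (x : ℕ) (e : Expr) (s : State) :
      Exec (.assign x e) s (e.cost + 1) (s.setVar x (e.eval s))
  | write (a : ℕ) (j e : Expr) (s : State) :
      Exec (.write a j e) s (j.cost + e.cost + 1) (s.setArr a (j.eval s) (e.eval s))
  | seq {p q : Prog} {s s₁ s₂ : State} {t₁ t₂ : ℕ} :
      Exec p s t₁ s₁ → Exec q s₁ t₂ s₂ → Exec (.seq p q) s (t₁ + t₂) s₂
  | cond_true {e : Expr} {p q : Prog} {s s₁ : State} {t : ℕ} :
      e.eval s ≠ 0 → Exec p s t s₁ → Exec (.cond e p q) s (e.cost + 1 + t) s₁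
  | cond_false {e : Expr} {p q : Prog} {s s₁ : State} {t : ℕ} :
      e.eval s = 0 → Exec q s t s₁ → Exec (.cond e p q) s (e.cost + 1 + t) s₁
  | loop_done {e : Expr} {p : Prog} {s : State} :
      e.eval s = 0 → Exec (.loop e p) s (e.cost + 1) s
  | loop_step {e : Expr} {p : Prog} {s s₁ s₂ : State} {t₁ t₂ : ℕ} :
      e.eval s ≠ 0 → Exec p s t₁ s₁ → Exec (.loop e p) s₁ t₂ s₂ →
      Exec (.loop e p) s (e.cost + 1 + t₁ + t₂) s₂

/-- The program determines the final state and the running time. -/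
theorem Exec.deterministic {p : Prog} {s s₁ s₂ : State} {t₁ t₂ : ℕ}
    (h₁ : Exec p s t₁ s₁) (h₂ : Exec p s t₂ s₂) : t₁ = t₂ ∧ s₁ = s₂ := by
  induction h₁ generalizing t₂ s₂ with
  | skip s => cases h₂; exact ⟨rfl, rfl⟩
  | assign x e s => cases h₂; exact ⟨rfl, rfl⟩
  | write a j e s => cases h₂; exact ⟨rfl, rfl⟩
  | seq _ _ ih₁ ih₂ =>
    cases h₂ with
    | seq k₁ k₂ =>
      obtain ⟨rfl, rfl⟩ := ih₁ k₁
      obtain ⟨rfl, rfl⟩ := ih₂ k₂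
      exact ⟨rfl, rfl⟩
  | cond_true h _ ih =>
    cases h₂ with
    | cond_true _ k => obtain ⟨rfl, rfl⟩ := ih k; exact ⟨rfl, rfl⟩
    | cond_false h' _ => exact absurd h' h
  | cond_false h _ ih =>
    cases h₂ with
    | cond_true h' _ => exact absurd h h'
    | cond_false _ k => obtain ⟨rfl, rfl⟩ := ih k; exact ⟨rfl, rfl⟩
  | loop_done h =>
    cases h₂ with
    | loop_done _ => exact ⟨rfl, rfl⟩
    | loop_step h' _ _ => exact absurd h h'
  | loop_step h _ _ ih₁ ih₂ =>
    cases h₂ with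
    | loop_done h' => exact absurd h' h
    | loop_step _ k₁ k₂ =>
      obtain ⟨rfl, rfl⟩ := ih₁ k₁
      obtain ⟨rfl, rfl⟩ := ih₂ k₂
      exact ⟨rfl, rfl⟩

/-- The length of an input word: the total number of binary digits of its entries, plus one
separator for each entry. -/
def bitLength (w : List ℕ) : ℕ :=
  (w.map fun m => Nat.size m + 1).sum

/-- There are one program and one polynomial such that, on every instance `x` that satisfies
`Promise`, the program started on the encoding of `x` halts with an output that is correct for `x`,
after a number of steps that is at most the polynomial in the bit length of the encoding. -/
def SolvableInPolyTime {α : Type} (encode : α → List ℕ) (Promise : α → Prop)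
    (Correct : α → List ℕ → Prop) : Prop :=
  ∃ (p : Prog) (P : Polynomial ℕ), ∀ x, Promise x →
    ∃ (t : ℕ) (s : State), Exec p (State.start (encode x)) t s ∧
      t ≤ P.eval (bitLength (encode x)) ∧ Correct x s.output

/-- A decision problem: the output has to be the word `1` on yes-instances and the word `0` on
no-instances. -/
def DecidableInPolyTime {α : Type} (encode : α → List ℕ) (Promise : α → Prop)
    (Yes : α → Prop) : Prop :=
  SolvableInPolyTime encode Promise fun x w => (Yes x ∧ w = [1]) ∨ (¬ Yes x ∧ w = [0])

end RAM

/-! On a path an item dominates itself and everything behind it. A bundle is therefore worth no more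
to an agent than its item nearest to the source of her path, and the dissatisfaction is the number
of vertices in front of that item. Hence one item per agent suffices (`exists_columns`). Adding `k`
dummy columns for "no item", of cost `|V_i|`, turns both problems into assignment problems for `k`
agents and `n + k` columns with costs at most `n`: minimum-sum assignment and bottleneck assignment.

Minimum-sum assignment is solved by an auction with price increment 1. An agent without a column
takes the one minimizing weight plus price and raises its price by 1. All assigned agents stay
within 1 of their optimum, so by linear programming duality the final total is within `k` of the
minimum (`AuctionInv.near_optimal`). With weights multiplied by `k + 1` this error vanishes
(`fill_auction_spec`). As long as an agent is without a column, some column is free at price 0. So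
prices never exceed the largest weight by more than 1, and every bid raises their sum; this bounds
the number of bids.

For the bottleneck problem, thresholds `0, 1, …` are tried in turn. The weight is the indicator of
exceeding the threshold, and minimum total 0 means that the threshold is feasible (`minMax_spec`).

Costs are positions on the path. They are found by `n` rounds of propagation along the arcs
(`Relaxed`).

The running time is handled once and for all: every loop is bounded by variable `0`, which holds the
input length, so a program is polynomial by its form alone (`exec_compile`). What remains is that
the input is long enough for these loops to finish their work. -/

namespace RAM

/-! ### Bounded-loop programs

A fragment of the programs in which every loop runs over a counter that is bounded by a variable
and by variable `0`, which is never modified. Such programs denote total functions on states, and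
their running time is bounded by a polynomial in the value of variable `0`. -/

namespace State

@[simp] theorem setVar_var (s : State) (x v y : ℕ) :
    (s.setVar x v).var y = if y = x then v else s.var y := by
  simp [setVar, Function.update_apply]

@[simp] theorem setVar_arr (s : State) (x v : ℕ) : (s.setVar x v).arr = s.arr := rfl

@[simp] theorem setArr_var (s : State) (a j v : ℕ) : (s.setArr a j v).var = s.var := rfl

@[simp] theorem setArr_arr (s : State) (a j v b : ℕ) :
    (s.setArr a j v).arr b = if b = a then Function.update (s.arr a) j v else s.arr b := by
  simp [setArr, Function.update_apply]

/-- Repeat `f`, with a counter in variable `x`. -/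
def iterate (f : State → State) (x : ℕ) (s : State) : ℕ → State
  | 0 => s.setVar x 0
  | i + 1 => (f (iterate f x s i)).setVar x (i + 1)

end State

inductive BProg where
  | assign (x : ℕ) (e : Expr)
  | write (a : ℕ) (j e : Expr)
  | seq (p q : BProg)
  | ite (e : Expr) (p q : BProg)
  | rep (x b : ℕ) (p : BProg)
  | skip

namespace BProg

/-- Sequential composition. -/
infixr:60 ";;" => BProg.seq

/-- The final state. `rep x b p` runs `p` with `x = 0, 1, …` as long as `x` is below both
variable `b` and variable `0`. -/
def run : BProg → State → State
  | skip, s => s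
  | assign x e, s => s.setVar x (e.eval s)
  | write a j e, s => s.setArr a (j.eval s) (e.eval s)
  | seq p q, s => q.run (p.run s)
  | ite e p q, s => if e.eval s ≠ 0 then p.run s else q.run s
  | rep x b p, s => State.iterate p.run x s (min (s.var b) (s.var 0))

/-- The variables that may be modified. -/
def modV : BProg → List ℕ
  | skip => []
  | assign x _ => [x]
  | write _ _ _ => []
  | seq p q => p.modV ++ q.modV
  | ite _ p q => p.modV ++ q.modV
  | rep x _ p => x :: p.modV

/-- The arrays that may be modified. -/
def modA : BProg → List ℕ
  | skip => []
  | assign _ _ => []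
  | write a _ _ => [a]
  | seq p q => p.modA ++ q.modA
  | ite _ p q => p.modA ++ q.modA
  | rep _ _ p => p.modA

/-- Loop counters, loop bounds and variable `0` are not tampered with. -/
def ok : BProg → Bool
  | skip => true
  | assign x _ => x != 0
  | write _ _ _ => true
  | seq p q => p.ok && q.ok
  | ite _ p q => p.ok && q.ok
  | rep x b p => x != 0 && x != b && !p.modV.contains x && !p.modV.contains b && p.ok

/-- The condition of a bounded loop: it is nonzero iff `x` is below `b` and variable `0`. -/
def guard (x b : ℕ) : Expr :=
  .sub (.sub (.var b) (.sub (.var b) (.var 0))) (.var x)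

def compile : BProg → Prog
  | skip => .skip
  | assign x e => .assign x e
  | write a j e => .write a j e
  | seq p q => .seq p.compile q.compile
  | ite e p q => .cond e p.compile q.compile
  | rep x b p => .seq (.assign x (.const 0))
      (.loop (guard x b) (.seq p.compile (.assign x (.add (.var x) (.const 1)))))

/-- A bound on the running time, in terms of variable `0`. -/
noncomputable def time : BProg → Polynomial ℕ
  | skip => 1
  | assign _ e => Polynomial.C (e.cost + 1)
  | write _ j e => Polynomial.C (j.cost + e.cost + 1)
  | seq p q => p.time + q.time
  | ite e p q => Polynomial.C (e.cost + 1) + p.time + q.time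
  | rep x b p => Polynomial.C 2 + (Polynomial.X * (p.time + Polynomial.C ((guard x b).cost + 5)) +
      Polynomial.C ((guard x b).cost + 1))

/-! ### Frames, loop invariants and running time of bounded-loop programs. -/

variable {p : BProg} {s : State}

/-- The side condition is Boolean so that `rfl` decides it for a concrete program. -/
theorem run_var {y : ℕ} (h : p.modV.contains y = false) : (p.run s).var y = s.var y := by
  induction p generalizing s with
  | skip => rfl
  | assign x e => simp [modV] at h; simp [run, h]
  | write a j e => rfl
  | seq p q ihp ihq =>
    simp [modV] at h
    rw [run, ihq (by simp [h]), ihp (by simp [h])]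
  | ite e p q ihp ihq =>
    simp [modV] at h
    rw [run]
    split_ifs
    · exact ihp (by simp [h])
    · exact ihq (by simp [h])
  | rep x b p ih =>
    simp [modV] at h
    rw [run]
    induction min (s.var b) (s.var 0) with
    | zero => simp [State.iterate, h]
    | succ i hi => simp [State.iterate, h, ih, hi]

theorem run_arr {a : ℕ} (h : p.modA.contains a = false) : (p.run s).arr a = s.arr a := by
  induction p generalizing s with
  | skip => rfl
  | assign x e => rfl
  | write b j e => simp [modA] at h; simp [run, h]
  | seq p q ihp ihq =>
    simp [modA] at h
    rw [run, ihq (by simp [h]), ihp (by simp [h])]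
  | ite e p q ihp ihq =>
    simp [modA] at h
    rw [run]
    split_ifs
    · exact ihp (by simp [h])
    · exact ihq (by simp [h])
  | rep x b p ih =>
    simp [modA] at h
    rw [run]
    induction min (s.var b) (s.var 0) with
    | zero => rfl
    | succ i hi => simp [State.iterate, h, ih, hi]

theorem modV_zero_of_ok (h : p.ok = true) : p.modV.contains 0 = false := by
  induction p with
  | skip => rfl
  | assign x e => simp [ok] at h; simp [modV, Ne.symm h]
  | write a j e => rfl
  | seq p q ihp ihq => simp_all [ok, modV]
  | ite e p q ihp ihq => simp_all [ok, modV]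
  | rep x b p ih =>
    simp [ok] at h
    simp at ih
    simp [modV, Ne.symm h.1.1.1.1, ih h.2]

/-- With truncated subtraction, `b - (b - v)` is `min b v`. -/
theorem eval_guard_ne_zero {x b : ℕ} :
    (guard x b).eval s ≠ 0 ↔ s.var x < min (s.var b) (s.var 0) := by
  simp [guard, Expr.eval]; omega

/-- States reached in a loop: the unmodified variables and arrays. -/
structure Frame (p : BProg) (s t : State) : Prop where
  var : ∀ y, p.modV.contains y = false → t.var y = s.var y
  arr : ∀ a, p.modA.contains a = false → t.arr a = s.arr a

theorem frame_run (p : BProg) (s : State) : Frame p s (p.run s) :=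
  ⟨fun _ => run_var, fun _ => run_arr⟩

theorem frame_iterate {x b : ℕ} (i : ℕ) :
    Frame (rep x b p) s (State.iterate p.run x s i) := by
  induction i with
  | zero =>
    refine ⟨fun y hy => ?_, fun _ _ => rfl⟩
    simp [modV] at hy
    simp [State.iterate, hy]
  | succ i ih =>
    refine ⟨fun y hy => ?_, fun a ha => ?_⟩
    · have := ih.var y hy
      simp [modV] at hy
      rw [State.iterate, State.setVar_var, if_neg hy.1, run_var (by simp [hy.2]), this]
    · have := ih.arr a ha
      rw [State.iterate, State.setVar_arr, run_arr (p := p) ha, this]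

theorem iterate_counter {x i : ℕ} : (State.iterate p.run x s i).var x = i := by
  cases i <;> simp [State.iterate]

/-- The invariant rule for bounded loops. -/
theorem rep_inv {x b : ℕ} (I : ℕ → State → Prop) {N : ℕ} (hN : min (s.var b) (s.var 0) = N)
    (h0 : I 0 (s.setVar x 0))
    (step : ∀ i t, i < N → t.var x = i → Frame (rep x b p) s t → I i t →
      I (i + 1) ((p.run t).setVar x (i + 1))) :
    I N ((rep x b p).run s) := by
  rw [run, hN]
  have key : ∀ i, i ≤ N → I i (State.iterate p.run x s i) := by
    intro i
    induction i with
    | zero => intro _; exact h0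
    | succ i ih =>
      intro hi
      exact step i _ hi iterate_counter (frame_iterate (b := b) i) (ih (by omega))
  exact key N le_rfl

/-- The body of a loop changes neither the counter nor the bound nor variable `0`. So there are at
most `s.var 0` iterations, and the bound for the body is the same in each of them. -/
theorem exec_compile (h : p.ok = true) (s : State) :
    ∃ t, Exec p.compile s t (p.run s) ∧ t ≤ p.time.eval (s.var 0) := by
  induction p generalizing s with
  | skip => exact ⟨1, .skip s, by simp [time]⟩
  | assign x e => exact ⟨_, .assign x e s, by simp [time]⟩
  | write a j e => exact ⟨_, .write a j e s, by simp [time]⟩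
  | seq p q ihp ihq =>
    simp only [ok, Bool.and_eq_true] at h
    obtain ⟨t₁, e₁, l₁⟩ := ihp h.1 s
    obtain ⟨t₂, e₂, l₂⟩ := ihq h.2 (p.run s)
    rw [run_var (modV_zero_of_ok h.1)] at l₂
    exact ⟨_, .seq e₁ e₂, by rw [time, Polynomial.eval_add]; omega⟩
  | ite e p q ihp ihq =>
    simp only [ok, Bool.and_eq_true] at h
    by_cases he : e.eval s ≠ 0
    · obtain ⟨t₁, e₁, l₁⟩ := ihp h.1 s
      refine ⟨e.cost + 1 + t₁, ?_, ?_⟩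
      · rw [run, if_pos he]; exact .cond_true he e₁
      · simp [time]; omega
    · obtain ⟨t₁, e₁, l₁⟩ := ihq h.2 s
      refine ⟨e.cost + 1 + t₁, ?_, ?_⟩
      · rw [run, if_neg he]; exact .cond_false (not_not.mp he) e₁
      · simp [time]; omega
  | rep x b p ih =>
    have hfr := fun i => frame_iterate (p := p) (s := s) (x := x) (b := b) i
    have h0 := modV_zero_of_ok h
    simp only [ok, Bool.and_eq_true, bne_iff_ne, Bool.not_eq_true'] at h
    obtain ⟨⟨⟨⟨hx0, hxb⟩, hxp⟩, hbp⟩, hp⟩ := h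
    have hb : (rep x b p).modV.contains b = false := by
      simp only [modV, List.contains_cons, hbp, Bool.or_false, beq_eq_false_iff_ne]
      exact hxb.symm
    set N := min (s.var b) (s.var 0) with hN
    set T := p.time.eval (s.var 0) with hT
    set G := (guard x b).cost with hG
    have loop : ∀ m i, i + m = N → ∃ t,
        Exec (.loop (guard x b) (.seq p.compile (.assign x (.add (.var x) (.const 1)))))
          (State.iterate p.run x s i) t (State.iterate p.run x s N) ∧
          -- One iteration costs `G + 1` for the test, at most `T` for the body and `4` for the
          -- increment; the last `G + 1` is the failing test.
          t ≤ m * (T + (G + 5)) + (G + 1) := by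
      intro m
      induction m with
      | zero =>
        intro i hi
        obtain rfl : i = N := by simpa using hi
        refine ⟨_, .loop_done ?_, by omega⟩
        by_contra hne
        have := eval_guard_ne_zero.mp hne
        rw [iterate_counter, (hfr _).var b hb, (hfr _).var 0 h0] at this
        omega
      | succ m ihm =>
        intro i hi
        obtain ⟨t₂, e₂, l₂⟩ := ihm (i + 1) (by omega)
        obtain ⟨t₁, e₁, l₁⟩ := ih hp (State.iterate p.run x s i)
        rw [(hfr i).var 0 h0] at l₁
        have ea := Exec.assign x (.add (.var x) (.const 1)) (p.run (State.iterate p.run x s i))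
        have hval : (Expr.add (.var x) (.const 1)).eval (p.run (State.iterate p.run x s i)) =
            i + 1 := by
          simp only [Expr.eval, run_var hxp, iterate_counter]
        rw [hval] at ea
        refine ⟨_, .loop_step ?_ (.seq e₁ ea) e₂, ?_⟩
        · rw [eval_guard_ne_zero, iterate_counter, (hfr _).var b hb, (hfr _).var 0 h0]
          omega
        · simp only [Expr.cost]
          rw [Nat.succ_mul]
          omega
    obtain ⟨t, e, l⟩ := loop N 0 (by simp)
    refine ⟨_, .seq (.assign x (.const 0) s) e, ?_⟩
    simp only [time, Expr.cost, Polynomial.eval_add, Polynomial.eval_mul, Polynomial.eval_X,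
      Polynomial.eval_C, ← hT, ← hG]
    have : N * (T + (G + 5)) ≤ s.var 0 * (T + (G + 5)) :=
      Nat.mul_le_mul_right _ (min_le_right _ _)
    omega

end BProg

/-- Time bounds are polynomials in variable `0`, the number of entries; this passes to the bit
length. -/
theorem length_le_bitLength (w : List ℕ) : w.length ≤ bitLength w := by
  induction w with
  | nil => simp [bitLength]
  | cons a w ih => simp only [bitLength, List.map_cons, List.sum_cons, List.length_cons] at *; omega

/-- A bounded-loop program followed by setting the output length solves a problem in polynomial
time. -/
theorem solvable_of_run {α : Type} {encode : α → List ℕ} {Promise : α → Prop}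
    {Correct : α → List ℕ → Prop} (p : BProg) (e : Expr) (hp : p.ok = true)
    (h : ∀ x, Promise x → Correct x
      ((List.range (e.eval (p.run (State.start (encode x))))).map
        ((p.run (State.start (encode x))).arr 0))) :
    SolvableInPolyTime encode Promise Correct := by
  refine ⟨.seq p.compile (.assign 0 e), p.time + Polynomial.C (e.cost + 1), fun x hx => ?_⟩
  obtain ⟨t, ht, hl⟩ := BProg.exec_compile hp (State.start (encode x))
  refine ⟨_, _, .seq ht (.assign 0 e _), ?_, ?_⟩
  · have h1 : (State.start (encode x)).var 0 ≤ bitLength (encode x) := length_le_bitLength _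
    have h2 : ∀ (q : Polynomial ℕ) (a b : ℕ), a ≤ b → q.eval a ≤ q.eval b := by
      intro q a b hab
      rw [Polynomial.eval_eq_sum, Polynomial.eval_eq_sum]
      exact Finset.sum_le_sum fun i _ => Nat.mul_le_mul_left _ (Nat.pow_le_pow_left hab i)
    have h3 := h2 p.time _ _ h1
    simp only [Polynomial.eval_add, Polynomial.eval_C]
    omega
  · simpa [State.output] using h x hx

end RAM

/-! ### The auction algorithm for the assignment problem -/

/-- The invariant of the auction among the agents `0, …, k - 1` for the columns `0, …, M - 1`:
`own j` is `0`, or `i + 1` for the agent `i` that holds `j`; `asg (i + 1)` is `0`, or `j + 1` for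
the column `j` that `i` holds; `P` are the prices. An agent is within one unit of the best she could
get at the current prices, and columns that nobody holds are free. -/
structure AuctionInv (k M B : ℕ) (w : ℕ → ℕ → ℕ) (P own asg : ℕ → ℕ) : Prop where
  asg_le : ∀ i < k, asg (i + 1) ≤ M
  own_le : ∀ j < M, own j ≤ k
  own_iff : ∀ j < M, ∀ i < k, own j = i + 1 ↔ asg (i + 1) = j + 1
  free : ∀ j < M, own j = 0 → P j = 0
  price_le : ∀ j < M, P j ≤ B + 1
  near_opt : ∀ i < k, ∀ j < M, asg (i + 1) = j + 1 → ∀ j' < M, w i j + P j ≤ w i j' + P j' + 1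

namespace AuctionInv

variable {k M B : ℕ} {w : ℕ → ℕ → ℕ} {P own asg : ℕ → ℕ}

theorem start (hP : ∀ j < M, P j = 0) (ho : ∀ j < M, own j = 0) (ha : ∀ i < k, asg (i + 1) = 0) :
    AuctionInv k M B w P own asg where
  asg_le i hi := by simp [ha i hi]
  own_le j hj := by simp [ho j hj]
  own_iff j hj i hi := by simp [ho j hj, ha i hi]
  free j hj _ := hP j hj
  price_le j hj := by simp [hP j hj]
  near_opt i hi j _ h := by simp [ha i hi] at h

/-- If all `M` columns were held, their distinct holders would be among the `k - 1` agents other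
than `i`. -/
theorem exists_free (h : AuctionInv k M B w P own asg) (hkM : k ≤ M) {i : ℕ} (hi : i < k)
    (hai : asg (i + 1) = 0) : ∃ j < M, own j = 0 := by
  by_contra! hne
  have hmaps : ∀ j ∈ Finset.range M, own j - 1 ∈ (Finset.range k).erase i := by
    intro j hj
    have hj := Finset.mem_range.mp hj
    have h1 := hne j hj
    have h2 := h.own_le j hj
    refine Finset.mem_erase.mpr ⟨fun he => ?_, Finset.mem_range.mpr (by omega)⟩
    have := (h.own_iff j hj i hi).mp (by omega)
    omega
  have hinj : Set.InjOn (fun j => own j - 1) (Finset.range M : Set ℕ) := by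
    intro j hj j' hj' he
    have hj := Finset.mem_range.mp hj
    have hj' := Finset.mem_range.mp hj'
    have h1 := hne j hj
    have h1' := hne j' hj'
    have h2 := h.own_le j hj
    have e1 := (h.own_iff j hj (own j - 1) (by omega)).mp (by omega)
    have e2 := (h.own_iff j' hj' (own j - 1) (by omega)).mp (by simp only at he; omega)
    omega
  have := Finset.card_le_card_of_injOn _ hmaps hinj
  rw [Finset.card_erase_of_mem (Finset.mem_range.mpr hi), Finset.card_range, Finset.card_range]
    at this
  omega

/-- An agent without a column takes the best column from whoever holds it, and raises its price. -/
theorem bid (h : AuctionInv k M B w P own asg) (hkM : k ≤ M)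
    (hw : ∀ i < k, ∀ j < M, w i j ≤ B) {i j : ℕ} (hi : i < k)
    (hai : asg (i + 1) = 0) (hj : j < M) (hbest : ∀ j' < M, w i j + P j ≤ w i j' + P j') :
    AuctionInv k M B w (Function.update P j (P j + 1)) (Function.update own j (i + 1))
      (Function.update (Function.update asg (own j) 0) (i + 1) (j + 1)) where
  asg_le i' hi' := by
    have := h.asg_le i' hi'
    simp only [Function.update_apply]
    split_ifs <;> omega
  own_le j' hj' := by
    have := h.own_le j' hj'
    simp only [Function.update_apply]
    split_ifs <;> omega
  own_iff j' hj' i' hi' := by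
    have h1 := h.own_iff j' hj' i' hi'
    have h2 := h.own_iff j hj i' hi'
    have h3 := h.own_iff j' hj' i hi
    simp only [Function.update_apply]
    split_ifs <;> grind
  free j' hj' := by
    have := h.free j' hj'
    simp only [Function.update_apply]
    split_ifs <;> grind
  -- Comparison with a free column `j₀`, whose price is 0, gives `P j ≤ B` before the raise.
  price_le j' hj' := by
    have := h.price_le j' hj'
    obtain ⟨j₀, hj₀, ho⟩ := h.exists_free hkM hi hai
    have h1 := h.free j₀ hj₀ ho
    have h2 := hbest j₀ hj₀
    have h3 := hw i hi j₀ hj₀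
    simp only [Function.update_apply]
    split_ifs <;> omega
  -- The bidder was exactly optimal before her price rose by 1. The other holders keep their prices,
  -- while the alternatives can only become dearer.
  near_opt i' hi' j' hj' ha j'' hj'' := by
    have h1 := hbest j'' hj''
    have h2 := fun e => h.near_opt i' hi' j' hj' e j'' hj''
    have h3 := h.own_iff j hj i' hi'
    simp only [Function.update_apply] at ha ⊢
    grind

theorem sum_price_le (h : AuctionInv k M B w P own asg) :
    ∑ j ∈ Finset.range M, P j ≤ M * (B + 1) := by
  have := Finset.sum_le_card_nsmul (Finset.range M) P (B + 1)
    fun j hj => h.price_le j (Finset.mem_range.mp hj)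
  simpa using this

theorem injOn (h : AuctionInv k M B w P own asg) (hall : ∀ i < k, asg (i + 1) ≠ 0) {i i' : ℕ}
    (hi : i < k) (hi' : i' < k) (he : asg (i + 1) = asg (i' + 1)) : i = i' := by
  have h1 := hall i hi
  have h2 := h.asg_le i hi
  have e1 := (h.own_iff (asg (i + 1) - 1) (by omega) i hi).mpr (by omega)
  have e2 := (h.own_iff (asg (i + 1) - 1) (by omega) i' hi').mpr (by omega)
  omega

/-- Once every agent holds a column, the total weight is optimal up to `k`. -/
theorem near_optimal (h : AuctionInv k M B w P own asg) (hall : ∀ i < k, asg (i + 1) ≠ 0)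
    (g : ℕ → ℕ) (hg : ∀ i < k, g i < M) (hinj : Set.InjOn g (Finset.range k)) :
    ∑ i ∈ Finset.range k, w i (asg (i + 1) - 1) ≤ (∑ i ∈ Finset.range k, w i (g i)) + k := by
  have hlt : ∀ i < k, asg (i + 1) - 1 < M := fun i hi => by
    have h1 := hall i hi
    have h2 := h.asg_le i hi
    omega
  have h1 : ∑ i ∈ Finset.range k, (w i (asg (i + 1) - 1) + P (asg (i + 1) - 1)) ≤
      ∑ i ∈ Finset.range k, (w i (g i) + P (g i) + 1) := by
    refine Finset.sum_le_sum fun i hi => ?_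
    have hi := Finset.mem_range.mp hi
    have h1 := hall i hi
    exact h.near_opt i hi _ (hlt i hi) (by omega) _ (hg i hi)
  -- The assignment of the auction collects all prices, since unheld columns are free, and `g`
  -- collects at most all of them. So the prices drop out of `h1`.
  have h2 : ∑ i ∈ Finset.range k, P (g i) ≤ ∑ j ∈ Finset.range M, P j := by
    rw [← Finset.sum_image (f := P) hinj]
    refine Finset.sum_le_sum_of_subset fun j hj => ?_
    obtain ⟨i, hi, rfl⟩ := Finset.mem_image.mp hj
    exact Finset.mem_range.mpr (hg i (Finset.mem_range.mp hi))
  have h3 : ∑ j ∈ Finset.range M, P j = ∑ i ∈ Finset.range k, P (asg (i + 1) - 1) := by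
    have hinj' : Set.InjOn (fun i => asg (i + 1) - 1) (Finset.range k : Set ℕ) := by
      intro i hi i' hi' he
      have hi := Finset.mem_range.mp hi
      have hi' := Finset.mem_range.mp hi'
      have h1 := hall i hi
      have h2 := hall i' hi'
      exact h.injOn hall hi hi' (by simp only at he; omega)
    rw [← Finset.sum_image (f := P) hinj']
    symm
    refine Finset.sum_subset (fun j hj => ?_) fun j hj hn => ?_
    · obtain ⟨i, hi, rfl⟩ := Finset.mem_image.mp hj
      exact Finset.mem_range.mpr (hlt i (Finset.mem_range.mp hi))
    · have hj := Finset.mem_range.mp hj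
      refine h.free j hj ?_
      by_contra hne
      have hle := h.own_le j hj
      refine hn (Finset.mem_image.mpr ⟨own j - 1, Finset.mem_range.mpr (by omega), ?_⟩)
      have := (h.own_iff j hj (own j - 1) (by omega)).mp (by omega)
      omega
  simp only [Finset.sum_add_distrib, Finset.sum_const, Finset.card_range, smul_eq_mul,
    mul_one] at h1
  omega

end AuctionInv

/-! ### Preference paths as an assignment problem -/

namespace Dissat

open Finset

namespace PrefGraph

variable {n : ℕ}

open Classical in
/-- The dissatisfaction of an agent who receives just column `j`, where the columns from `n` on
stand for no item at all. -/
noncomputable def cost (G : PrefGraph n) (j : ℕ) : ℕ :=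
  (G.verts.filter fun u => ¬ ∃ v : Fin n, v.val = j ∧ G.IsDominatedBy u v).card

theorem cost_le (G : PrefGraph n) (j : ℕ) : G.cost j ≤ n := by
  classical
  exact ((card_filter_le _ _).trans (card_le_univ _)).trans_eq (Fintype.card_fin n)

theorem cost_of_notMem (G : PrefGraph n) {j : ℕ} (h : ∀ v ∈ G.verts, v.val ≠ j) :
    G.cost j = G.verts.card := by
  classical
  rw [cost, filter_true_of_mem]
  rintro u - ⟨v, hv, -, hmem, -⟩
  exact h v hmem hv

/-- `p` enumerates the path `G`. -/
structure PathEnum (G : PrefGraph n) (ℓ : ℕ) (p : ℕ → Fin n) : Prop where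
  inj : ∀ a ≤ ℓ, ∀ b ≤ ℓ, p a = p b → a = b
  mem : ∀ v, v ∈ G.verts ↔ ∃ a ≤ ℓ, p a = v
  arc : ∀ u v, (u, v) ∈ G.arcs ↔ ∃ a < ℓ, p a = u ∧ p (a + 1) = v

theorem IsPath.exists_pathEnum {G : PrefGraph n} (h : G.IsPath) : ∃ ℓ p, PathEnum G ℓ p := by
  obtain ⟨ℓ, p, hinj, hv, ha⟩ := h
  -- Beyond `ℓ` the value `p 0` is a filler; `PathEnum` only speaks of indices up to `ℓ`.
  refine ⟨ℓ, fun a => if h : a < ℓ + 1 then p ⟨a, h⟩ else p 0, ?_, ?_, ?_⟩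
  · intro a ha b hb he
    simp only [Nat.lt_succ_of_le ha, Nat.lt_succ_of_le hb, dif_pos] at he
    simpa using hinj he
  · intro v
    rw [hv, mem_image]
    constructor
    · rintro ⟨a, -, rfl⟩
      exact ⟨a, Nat.le_of_lt_succ a.2, dif_pos a.2⟩
    · rintro ⟨a, ha, rfl⟩
      exact ⟨⟨a, Nat.lt_succ_of_le ha⟩, mem_univ _, by simp [Nat.lt_succ_of_le ha]⟩
  · intro u v
    rw [ha, mem_image]
    constructor
    · rintro ⟨a, -, he⟩
      rw [Prod.mk.injEq] at he
      obtain ⟨rfl, rfl⟩ := he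
      refine ⟨a, a.2, ?_, ?_⟩
      · simp [Nat.lt_succ_of_lt a.2]; rfl
      · simp; rfl
    · rintro ⟨a, ha, rfl, rfl⟩
      refine ⟨⟨a, ha⟩, mem_univ _, ?_⟩
      simp [ha, Nat.lt_succ_of_lt ha]

namespace PathEnum

variable {G : PrefGraph n} {ℓ : ℕ} {p : ℕ → Fin n}

/-- Every arc raises the index by exactly one, and injectivity makes the index of a vertex unique.
-/
theorem reach_iff (h : PathEnum G ℓ p) {a b : ℕ} (ha : a ≤ ℓ) (hb : b ≤ ℓ) :
    Relation.ReflTransGen (fun x y => (x, y) ∈ G.arcs) (p a) (p b) ↔ a ≤ b := by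
  constructor
  · intro hr
    have key : ∀ y, Relation.ReflTransGen (fun x y => (x, y) ∈ G.arcs) (p a) y →
        ∃ b, a ≤ b ∧ b ≤ ℓ ∧ p b = y := by
      intro y hy
      induction hy with
      | refl => exact ⟨a, le_rfl, ha, rfl⟩
      | tail _ hyz ih =>
        obtain ⟨b, hab, hb, rfl⟩ := ih
        obtain ⟨c, hc, h1, rfl⟩ := (h.arc _ _).mp hyz
        have := h.inj c hc.le b hb h1
        exact ⟨c + 1, by omega, hc, rfl⟩
    obtain ⟨b', hab, hb', he⟩ := key _ hr
    rwa [← h.inj b' hb' b hb he]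
  · intro hab
    induction b, hab using Nat.le_induction with
    | base => exact .refl
    | succ b hab ih => exact .tail (ih (by omega)) ((h.arc _ _).mpr ⟨b, hb, rfl, rfl⟩)

theorem isDominatedBy_iff (h : PathEnum G ℓ p) {a b : ℕ} (ha : a ≤ ℓ) (hb : b ≤ ℓ) :
    G.IsDominatedBy (p a) (p b) ↔ b ≤ a := by
  have hm : ∀ c ≤ ℓ, p c ∈ G.verts := fun c hc => (h.mem _).mpr ⟨c, hc, rfl⟩
  simp only [IsDominatedBy, pred, Set.mem_ofPred_eq, hm a ha, hm b hb, h.reach_iff hb ha, true_and]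
  constructor
  · rintro (he | he)
    · exact (h.inj _ ha _ hb he).ge
    · exact he.2
  · intro hba
    rcases eq_or_ne (p a) (p b) with he | he
    · exact .inl he
    · exact .inr ⟨he.symm, hba⟩

theorem injOn (h : PathEnum G ℓ p) : Set.InjOn p (range (ℓ + 1)) := fun a ha b hb he =>
  h.inj a (Nat.le_of_lt_succ (mem_range.mp ha)) b (Nat.le_of_lt_succ (mem_range.mp hb)) he

theorem length_lt (h : PathEnum G ℓ p) : ℓ < n := by
  have h1 := card_image_of_injOn h.injOn
  have h2 := card_le_univ ((range (ℓ + 1)).image p)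
  rw [h1, card_range, Fintype.card_fin] at h2
  exact h2

/-- Counting the vertices in front of a given one. -/
theorem card_filter_eq (h : PathEnum G ℓ p) (Q : Fin n → Prop) [DecidablePred Q] {a : ℕ}
    (ha : a ≤ ℓ) (hQ : ∀ b ≤ ℓ, Q (p b) ↔ b < a) : (G.verts.filter Q).card = a := by
  have : G.verts.filter Q = (range a).image p := by
    ext v
    simp only [mem_filter, h.mem, mem_image, mem_range]
    constructor
    · rintro ⟨⟨b, hb, rfl⟩, hq⟩
      exact ⟨b, (hQ b hb).mp hq, rfl⟩
    · rintro ⟨b, hb, rfl⟩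
      exact ⟨⟨b, by omega, rfl⟩, (hQ b (by omega)).mpr hb⟩
  rw [this, card_image_of_injOn (h.injOn.mono fun b hb => ?_), card_range]
  simp only [coe_range, Set.mem_Iio] at hb ⊢
  omega

/-- The vertices left undominated are the `a` vertices in front of `p a`. -/
theorem cost_eq (h : PathEnum G ℓ p) {a : ℕ} (ha : a ≤ ℓ) : G.cost (p a) = a := by
  classical
  refine h.card_filter_eq _ ha fun b hb => ?_
  rw [← not_le, ← h.isDominatedBy_iff hb ha, not_iff_not]
  constructor
  · rintro ⟨v, hv, hd⟩
    rwa [Fin.ext hv] at hd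
  · exact fun hd => ⟨_, rfl, hd⟩

end PathEnum

end PrefGraph

namespace Profile

variable {I : Profile}

/-- Some single column serves each agent as well as her bundle does. -/
theorem exists_columns (hI : I.AllPaths) (π : I.Allocation) :
    ∃ g : ℕ → ℕ, (∀ i < I.k, g i < I.n + I.k) ∧ Set.InjOn g (range I.k) ∧
      ∀ i : Fin I.k, (I.graph i).cost (g i) = I.dissat π i := by
  classical
  have key : ∀ i : Fin I.k, ∃ j : ℕ, (j = I.n + i ∨ ∃ v ∈ π.bundle i, v.val = j) ∧
      (I.graph i).cost j = I.dissat π i := by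
    intro i
    obtain ⟨ℓ, p, hp⟩ := (hI i).exists_pathEnum
    -- The item of the bundle nearest to the source does the work of the whole bundle. If the bundle
    -- misses the path, the agent takes her private dummy column `n + i`, which keeps the choice
    -- injective.
    by_cases hex : ∃ a, a ≤ ℓ ∧ p a ∈ π.bundle i
    · obtain ⟨hle, hmem⟩ := Nat.find_spec hex
      refine ⟨p (Nat.find hex), .inr ⟨_, hmem, rfl⟩, ?_⟩
      rw [hp.cost_eq hle, dissat, hp.card_filter_eq _ hle]
      intro b hb
      rw [not_iff_comm, not_lt]
      constructor
      · exact fun hle' => ⟨_, hmem, (hp.isDominatedBy_iff hb hle).mpr hle'⟩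
      · rintro ⟨v, hv, hd⟩
        obtain ⟨c, hc, rfl⟩ := (hp.mem v).mp hd.2.1
        exact (Nat.find_min' hex ⟨hc, hv⟩).trans ((hp.isDominatedBy_iff hb hc).mp hd)
    · refine ⟨I.n + i, .inl rfl, ?_⟩
      rw [PrefGraph.cost_of_notMem _ (fun v _ => by omega), dissat, filter_true_of_mem]
      rintro u - ⟨v, hv, hd⟩
      obtain ⟨c, hc, rfl⟩ := (hp.mem v).mp hd.2.1
      exact hex ⟨c, hc, hv⟩
  choose g hg hc using key
  refine ⟨fun i => if h : i < I.k then g ⟨i, h⟩ else 0, fun i hi => ?_, ?_, fun i => ?_⟩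
  · simp only [hi, dif_pos]
    rcases hg ⟨i, hi⟩ with h | ⟨v, -, h⟩
    · simp only [h]; omega
    · rw [← h]; omega
  · intro i hi i' hi' he
    have hi := mem_range.mp hi
    have hi' := mem_range.mp hi'
    simp only [hi, hi', dif_pos] at he
    rcases hg ⟨i, hi⟩ with h | ⟨v, hv, h⟩ <;> rcases hg ⟨i', hi'⟩ with h' | ⟨v', hv', h'⟩
    · simp only at h h'; omega
    · simp only at h; omega
    · simp only at h'; omega
    · by_contra hne
      have hd := π.disjoint ⟨i, hi⟩ ⟨i', hi'⟩ (by simpa using hne)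
      obtain rfl : v = v' := Fin.ext (by omega)
      exact disjoint_left.mp hd hv hv'
  · simpa using hc i

/-- The allocation that gives every agent her column. -/
def ofColumns (I : Profile) (f : ℕ → ℕ) (hinj : Set.InjOn f (range I.k)) : I.Allocation where
  bundle i := univ.filter fun v => f i = v.val
  disjoint i j hij := by
    rw [disjoint_left]
    intro v hi hj
    simp only [mem_filter, mem_univ, true_and] at hi hj
    exact hij (Fin.ext (hinj (mem_range.mpr i.2) (mem_range.mpr j.2) (hi.trans hj.symm)))

theorem dissat_ofColumns (f : ℕ → ℕ) (hinj : Set.InjOn f (range I.k)) (i : Fin I.k) :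
    I.dissat (I.ofColumns f hinj) i = (I.graph i).cost (f i) := by
  classical
  rw [dissat, PrefGraph.cost]
  congr 1
  ext u
  simp [ofColumns, eq_comm]

end Profile

end Dissat

namespace RAM

namespace BProg

/-! ### Elementary subprograms -/

/-- Set the first `var 0` cells of array `a` to the value of `e`. -/
def clear (a : ℕ) (e : Expr) : BProg := rep 7 0 (write a (.var 7) e)

theorem clear_spec {a : ℕ} {e : Expr} {s : State} {c : ℕ}
    (he : ∀ t, Frame (clear a e) s t → e.eval t = c) {x : ℕ} (hx : x < s.var 0) :
    ((clear a e).run s).arr a x = c := by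
  refine rep_inv (x := 7) (b := 0) (p := write a (.var 7) e) (s := s) (N := s.var 0)
    (fun i t => ∀ x < i, t.arr a x = c) (by simp) (by simp) ?_ x hx
  intro i t hi ht hf ih x hx
  simp only [run, State.setVar_arr, State.setArr_arr, if_true, Expr.eval, ht, he t hf,
    Function.update_apply]
  split_ifs with h
  · rfl
  · exact ih x (by omega)

/-- Store the multiples of variable `y` in array `a`. -/
def table (a y : ℕ) : BProg :=
  assign 6 (.const 0) ;;
  rep 7 0 (write a (.var 7) (.var 6) ;; assign 6 (.add (.var 6) (.var y)))

theorem table_spec {a y : ℕ} {s : State} (h6 : y ≠ 6) (h7 : y ≠ 7) {x : ℕ} (hx : x < s.var 0) :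
    ((table a y).run s).arr a x = x * s.var y := by
  rw [table, run]
  refine (rep_inv (N := s.var 0)
    (fun i t => t.var 6 = i * s.var y ∧ ∀ x < i, t.arr a x = x * s.var y)
    (by simp [run]) (by simp [run, Expr.eval]) ?_).2 x hx
  intro i t hi ht hf ⟨h1, h2⟩
  have hy : t.var y = s.var y := by
    rw [hf.var y (by simp [modV, h6, h7])]
    simp [run, h6]
  constructor
  · simp [run, Expr.eval, h1, hy, Nat.succ_mul]
  · intro x hx
    simp only [run, State.setVar_arr, State.setArr_arr, if_true, Expr.eval, ht, h1,
      Function.update_apply]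
    split_ifs with h
    · rw [h]
    · exact h2 x (by omega)

/-- Sum up the values of `e` in variable `y`. -/
def accum (y x b : ℕ) (e : Expr) : BProg :=
  assign y (.const 0) ;; rep x b (assign y (.add (.var y) e))

/-- The frame in `he` is what `e` may rely on: everything the loop does not modify is as in `s`. -/
theorem accum_spec {y x b : ℕ} {e : Expr} {s : State} {N : ℕ} (g : ℕ → ℕ) (hy0 : y ≠ 0)
    (hxy : x ≠ y) (hyb : y ≠ b) (hN : min (s.var b) (s.var 0) = N)
    (he : ∀ i t, i < N → t.var x = i → Frame (accum y x b e) s t → e.eval t = g i) :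
    ((accum y x b e).run s).var y = ∑ i ∈ Finset.range N, g i := by
  rw [accum, run]
  refine rep_inv (N := N) (fun i t => t.var y = ∑ i ∈ Finset.range i, g i)
    (by simp [run, hy0.symm, hyb.symm, hN]) (by simp [run, Expr.eval, hxy.symm]) ?_
  intro i t hi ht hf ih
  have := he i t hi ht ⟨fun z hz => ?_, fun a ha => ?_⟩
  · simp [run, Expr.eval, hxy.symm, ih, this, Finset.sum_range_succ]
  · simp only [accum, modV, List.cons_append, List.nil_append, List.contains_cons,
      Bool.or_eq_false_iff, beq_eq_false_iff_ne] at hz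
    rw [hf.var z (by simp [modV, hz])]
    simp [run, hz.1]
  · exact hf.arr a (by simp [modA])

/-- Set row `var 8` of the matrix in array `a` to the values of `e`; the row starts are in array
`τ`, and the row length is in variable `b`. -/
def fillRow (a τ b : ℕ) (e : Expr) : BProg :=
  rep 9 b (write a (.add (.read τ (.var 8)) (.var 9)) e)

theorem fillRow_spec {a τ b : ℕ} {e : Expr} {s : State} {N : ℕ} (g : ℕ → ℕ) (haτ : a ≠ τ)
    (hN : min (s.var b) (s.var 0) = N)
    (he : ∀ j t, j < N → t.var 9 = j → Frame (fillRow a τ b e) s t → e.eval t = g j) :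
    (∀ j < N, ((fillRow a τ b e).run s).arr a (s.arr τ (s.var 8) + j) = g j) ∧
      ∀ x < s.arr τ (s.var 8), ((fillRow a τ b e).run s).arr a x = s.arr a x := by
  refine rep_inv (N := N) (fun i t => (∀ j < i, t.arr a (s.arr τ (s.var 8) + j) = g j) ∧
    ∀ x < s.arr τ (s.var 8), t.arr a x = s.arr a x) hN (by simp) ?_
  intro i t hi ht hf ⟨h1, h2⟩
  have e1 : t.arr τ = s.arr τ := hf.arr τ (by simp [modA, haτ.symm])
  have e2 : t.var 8 = s.var 8 := hf.var 8 (by simp [modV])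
  have e3 := he i t hi ht hf
  simp only [run, State.setVar_arr, State.setArr_arr, if_true, Expr.eval, ht, e1, e2, e3,
    Function.update_apply]
  constructor
  · intro j hj
    split_ifs with h
    · rw [show j = i by omega]
    · exact h1 j (by omega)
  · intro x hx
    rw [if_neg (by omega)]
    exact h2 x hx

/-- A loop over the rows of a matrix. -/
theorem rows_spec {a : ℕ} {q : BProg} {s : State} {k m : ℕ} (g : ℕ → ℕ → ℕ)
    (hk : min (s.var 1) (s.var 0) = k)
    (hq : ∀ i t, i < k → t.var 8 = i → Frame (rep 8 1 q) s t →
      (∀ j < m, (q.run t).arr a (i * m + j) = g i j) ∧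
      ∀ x < i * m, (q.run t).arr a x = t.arr a x) :
    ∀ i < k, ∀ j < m, ((rep 8 1 q).run s).arr a (i * m + j) = g i j := by
  refine rep_inv (N := k) (fun i t => ∀ i' < i, ∀ j < m, t.arr a (i' * m + j) = g i' j) hk
    (by simp) ?_
  intro i t hi ht hf ih i' hi' j hj
  obtain ⟨h1, h2⟩ := hq i t hi ht hf
  rw [State.setVar_arr]
  rcases Nat.lt_succ_iff_lt_or_eq.mp hi' with h | rfl
  -- Earlier rows lie below `i * m` and are untouched; cells behind the current row may hold
  -- anything.
  · rw [h2, ih i' h j hj]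
    have : (i' + 1) * m ≤ i * m := Nat.mul_le_mul_right _ h
    rw [Nat.succ_mul] at this
    omega
  · exact h1 j hj

/-- Fill a matrix with `var 1` rows. -/
def fill (a τ b : ℕ) (e : Expr) : BProg := rep 8 1 (fillRow a τ b e)

theorem fill_spec {a τ b : ℕ} {e : Expr} {s : State} {k m : ℕ} (g : ℕ → ℕ → ℕ) (haτ : a ≠ τ)
    (hb8 : b ≠ 8) (hb9 : b ≠ 9)
    (hk : min (s.var 1) (s.var 0) = k) (hm : min (s.var b) (s.var 0) = m)
    (hτ : ∀ i < k, s.arr τ i = i * m)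
    (he : ∀ i j t, i < k → j < m → t.var 8 = i → t.var 9 = j → Frame (fill a τ b e) s t →
      e.eval t = g i j) :
    ∀ i < k, ∀ j < m, ((fill a τ b e).run s).arr a (i * m + j) = g i j := by
  refine rows_spec g hk fun i t hi ht hf => ?_
  have e1 : t.arr τ = s.arr τ := hf.arr τ (by simp [modA, fillRow, haτ.symm])
  have e2 : t.arr τ (t.var 8) = i * m := by rw [ht, e1, hτ i hi]
  have e3 : ∀ y, y ≠ 8 → y ≠ 9 → t.var y = s.var y := fun y h8 h9 =>
    hf.var y (by simp [modV, fillRow, h8, h9])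
  rw [← e2]
  refine fillRow_spec (g i) haτ
    (by rw [e3 b hb8 hb9, e3 0 (by simp) (by simp), hm]) fun j t' hj ht' hf' =>
    he i j t' hi hj ?_ ht' ⟨fun z hz => ?_, fun z hz => ?_⟩
  · rw [hf'.var 8 (by simp [modV, fillRow]), ht]
  · rw [hf'.var z (by simp_all [modV, fill, fillRow]), hf.var z hz]
  · rw [hf'.arr z hz, hf.arr z hz]

end BProg

end RAM

namespace RAM

namespace BProg

/-! ### The programs

Variables: `0` input length, `1` number of agents `k`, `2` number of items `n`, `3` number of columns
`n + k`, `4` size of the block of an agent in the input, `5` the number `k + 1`, `12` number of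
vertices of the current agent, `13` bidding agent, `14` her best column, `17` threshold, `19` total
excess, `20` start of the first block; the others are counters.

Arrays: `0` input and output, `1` multiples of `n`, `2` multiples of `n + k`, `3` multiples of the
block size, `4` multiples of `k + 1`, `5` costs of the current agent, `6` cost matrix, `7` weight
matrix, `8` prices, `9` holders of the columns, `10` columns of the agents. -/

/-- Read `k` and `n` at position `o` of the input, and set up the tables of multiples. -/
def readHeader (o : ℕ) : BProg :=
  assign 1 (.read 0 (.const o)) ;;
  assign 2 (.read 0 (.const (o + 1))) ;;
  -- Without agents the input contains no graphs, so its length does not bound `n`; replacing `n` by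
  -- 0 is then harmless.
  ite (.var 1) skip (assign 2 (.const 0)) ;;
  assign 20 (.const (o + 2)) ;;
  assign 3 (.add (.var 2) (.var 1)) ;;
  assign 5 (.add (.var 1) (.const 1)) ;;
  table 1 2 ;;
  -- There is no multiplication: `n * n` is looked up in the table of multiples of `n`.
  assign 4 (.add (.var 2) (.read 1 (.var 2))) ;;
  table 2 3 ;; table 3 4 ;; table 4 5

/-- What `readHeader` establishes. -/
structure Env (L k n o : ℕ) (s : State) : Prop where
  v0 : s.var 0 = L
  v1 : s.var 1 = k
  v2 : s.var 2 = n
  v3 : s.var 3 = n + k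
  v20 : s.var 20 = o + 2
  a1 : ∀ x < L, s.arr 1 x = x * n
  a2 : ∀ x < L, s.arr 2 x = x * (n + k)
  a3 : ∀ x < L, s.arr 3 x = x * (n + n * n)
  a4 : ∀ x < L, s.arr 4 x = x * (k + 1)
  -- `lt` lets the loops over agents, items and columns run in full and keeps table lookups in
  -- range; `lt'` bounds the highest price of the auction.
  lt : n + k + 2 ≤ L
  lt' : (k + 1) * n + 1 ≤ L

/-- The variables and arrays that `Env` is about are not modified. -/
def keepsEnv (p : BProg) : Bool :=
  [0, 1, 2, 3, 20].all (fun x => !p.modV.contains x) && [1, 2, 3, 4].all (fun a => !p.modA.contains a)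

theorem Env.frame {L k n o : ℕ} {s t : State} {p : BProg} (h : Env L k n o s) (hf : Frame p s t)
    (hp : p.keepsEnv = true) : Env L k n o t := by
  simp only [keepsEnv, List.all_cons, List.all_nil, Bool.and_eq_true, Bool.not_eq_true',
    and_true] at hp
  obtain ⟨⟨h0, h1, h2, h3, h20⟩, g1, g2, g3, g4⟩ := hp
  constructor
  · rw [hf.var 0 h0, h.v0]
  · rw [hf.var 1 h1, h.v1]
  · rw [hf.var 2 h2, h.v2]
  · rw [hf.var 3 h3, h.v3]
  · rw [hf.var 20 h20, h.v20]
  · rw [hf.arr 1 g1]; exact h.a1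
  · rw [hf.arr 2 g2]; exact h.a2
  · rw [hf.arr 3 g3]; exact h.a3
  · rw [hf.arr 4 g4]; exact h.a4
  · exact h.lt
  · exact h.lt'

theorem Env.run {L k n o : ℕ} {s : State} {p : BProg} (h : Env L k n o s)
    (hp : p.keepsEnv = true) : Env L k n o (p.run s) :=
  h.frame (frame_run p s) hp

theorem Env.min1 {L k n o : ℕ} {s : State} (h : Env L k n o s) : min (s.var 1) (s.var 0) = k := by
  have := h.lt
  rw [h.v0, h.v1]; omega

theorem Env.min2 {L k n o : ℕ} {s : State} (h : Env L k n o s) : min (s.var 2) (s.var 0) = n := by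
  have := h.lt
  rw [h.v0, h.v2]; omega

theorem Env.min3 {L k n o : ℕ} {s : State} (h : Env L k n o s) :
    min (s.var 3) (s.var 0) = n + k := by
  have := h.lt
  rw [h.v0, h.v3]; omega

theorem readHeader_spec {o k n : ℕ} {s : State} (hk : s.arr 0 o = k)
    (hn : (if k = 0 then 0 else s.arr 0 (o + 1)) = n) (h1 : n + k + 2 ≤ s.var 0)
    (h2 : (k + 1) * n + 1 ≤ s.var 0) : Env (s.var 0) k n o ((readHeader o).run s) := by
  let q : BProg :=
    assign 1 (.read 0 (.const o)) ;;
    assign 2 (.read 0 (.const (o + 1))) ;;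
    ite (.var 1) skip (assign 2 (.const 0)) ;;
    assign 20 (.const (o + 2)) ;;
    assign 3 (.add (.var 2) (.var 1)) ;;
    assign 5 (.add (.var 1) (.const 1))
  let q' : BProg := assign 4 (.add (.var 2) (.read 1 (.var 2)))
  have hq : (q.run s).var 0 = s.var 0 ∧ (q.run s).var 1 = k ∧ (q.run s).var 2 = n ∧
      (q.run s).var 3 = n + k ∧ (q.run s).var 20 = o + 2 ∧ (q.run s).var 5 = k + 1 := by
    subst hn hk
    by_cases h0 : s.arr 0 o = 0 <;> simp [q, run, Expr.eval, h0]
  have e : (readHeader o).run s =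
      (table 4 5).run ((table 3 4).run ((table 2 3).run (q'.run ((table 1 2).run (q.run s))))) := rfl
  rw [e]
  set s₀ := q.run s
  obtain ⟨c0, c1, c2, c3, c20, c5⟩ := hq
  have t1 : ∀ x < s.var 0, ((table 1 2).run s₀).arr 1 x = x * n := fun x hx => by
    rw [table_spec (by simp) (by simp) (by rwa [c0]), c2]
  have c4 : (q'.run ((table 1 2).run s₀)).var 4 = n + n * n := by
    have : ((table 1 2).run s₀).var 2 = n := by rw [run_var rfl, c2]
    simp only [q', run, State.setVar_var, if_true, Expr.eval, this, t1 n (by omega)]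
  constructor
  · rw [run_var rfl, run_var rfl, run_var rfl, run_var rfl, run_var rfl, c0]
  · rw [run_var rfl, run_var rfl, run_var rfl, run_var rfl, run_var rfl, c1]
  · rw [run_var rfl, run_var rfl, run_var rfl, run_var rfl, run_var rfl, c2]
  · rw [run_var rfl, run_var rfl, run_var rfl, run_var rfl, run_var rfl, c3]
  · rw [run_var rfl, run_var rfl, run_var rfl, run_var rfl, run_var rfl, c20]
  · intro x hx
    rw [run_arr rfl, run_arr rfl, run_arr rfl, run_arr rfl, t1 x hx]
  · intro x hx
    rw [run_arr rfl, run_arr rfl, table_spec (by simp) (by simp), run_var rfl, run_var rfl, c3]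
    rwa [run_var rfl, run_var rfl, c0]
  · intro x hx
    rw [run_arr rfl, table_spec (by simp) (by simp), run_var rfl, c4]
    rwa [run_var rfl, run_var rfl, run_var rfl, c0]
  · intro x hx
    rw [table_spec (by simp) (by simp), run_var rfl, run_var rfl, run_var rfl, run_var rfl, c5]
    rwa [run_var rfl, run_var rfl, run_var rfl, run_var rfl, c0]
  · exact h1
  · exact h2

/-! #### The auction -/

/-- Find an agent without a column; the result is `k` if there is none. -/
def pick : BProg :=
  assign 13 (.var 1) ;;
  rep 8 1 (ite (.read 10 (.add (.var 8) (.const 1))) skip (assign 13 (.var 8)))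

/-- The weight plus the price of the column in variable `x`, for the bidding agent. -/
def offer (x : ℕ) : Expr :=
  .add (.read 7 (.add (.read 2 (.var 13)) (.var x))) (.read 8 (.var x))

def best : BProg :=
  assign 14 (.const 0) ;;
  rep 9 3 (ite (.sub (offer 14) (offer 9)) (assign 14 (.var 9)) skip)

def bid : BProg :=
  -- If the column is free, its holder is `0` and this clears cell `0`, which belongs to no agent.
  write 10 (.read 9 (.var 14)) (.const 0) ;;
  write 9 (.var 14) (.add (.var 13) (.const 1)) ;;
  write 10 (.add (.var 13) (.const 1)) (.add (.var 14) (.const 1)) ;;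
  write 8 (.var 14) (.add (.read 8 (.var 14)) (.const 1))

def round : BProg := pick ;; ite (.sub (.var 1) (.var 13)) (best ;; bid) skip

def auction : BProg :=
  clear 8 (.const 0) ;; clear 9 (.const 0) ;; clear 10 (.const 0) ;; rep 15 0 (rep 16 0 round)

variable {L k n o : ℕ} {s : State}

theorem pick_spec (h : Env L k n o s) :
    ((pick.run s).var 13 = k ∧ ∀ i < k, s.arr 10 (i + 1) ≠ 0) ∨
      ((pick.run s).var 13 < k ∧ s.arr 10 ((pick.run s).var 13 + 1) = 0) := by
  rw [pick, run]
  refine rep_inv (N := k) (fun x t => (t.var 13 = k ∧ ∀ i < x, s.arr 10 (i + 1) ≠ 0) ∨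
    (t.var 13 < k ∧ s.arr 10 (t.var 13 + 1) = 0)) ?_ ?_ ?_
  · rw [run_var rfl, run_var rfl, h.min1]
  · left
    simp [run, Expr.eval, h.v1]
  · intro i t hi ht hf ih
    have e : t.arr 10 = s.arr 10 := hf.arr 10 rfl
    by_cases h0 : s.arr 10 (i + 1) = 0
    · right
      simp [run, Expr.eval, ht, e, h0, hi]
    · rcases ih with ⟨h1, h2⟩ | h1
      · left
        simp only [run, Expr.eval, ht, e, h0, ne_eq, not_false_eq_true, if_true,
          State.setVar_var, Nat.reduceEqDiff, if_false]
        refine ⟨h1, fun i' hi' => ?_⟩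
        rcases Nat.lt_succ_iff_lt_or_eq.mp hi' with h | rfl
        · exact h2 i' h
        · exact h0
      · right
        simpa [run, Expr.eval, ht, e, h0] using h1

theorem best_spec (h : Env L k n o s) {i : ℕ} (hi : i < k) (h13 : s.var 13 = i)
    {w : ℕ → ℕ → ℕ} (hw : ∀ i < k, ∀ j < n + k, s.arr 7 (i * (n + k) + j) = w i j) :
    (best.run s).var 14 < n + k ∧ ∀ j < n + k,
      w i ((best.run s).var 14) + s.arr 8 ((best.run s).var 14) ≤ w i j + s.arr 8 j := by
  have hlt := h.lt
  rw [best, run]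
  refine rep_inv (N := n + k) (fun y t => t.var 14 < n + k ∧ ∀ j < y,
    w i (t.var 14) + s.arr 8 (t.var 14) ≤ w i j + s.arr 8 j) ?_ ?_ ?_
  · rw [run_var rfl, run_var rfl, h.min3]
  · simp [run, Expr.eval]; omega
  · intro y t hy ht hf ⟨h1, h2⟩
    have e2 : t.arr 2 i = i * (n + k) := by rw [hf.arr 2 rfl]; exact h.a2 i (by omega)
    have e7 : t.arr 7 = s.arr 7 := hf.arr 7 rfl
    have e8 : t.arr 8 = s.arr 8 := hf.arr 8 rfl
    have e13 : t.var 13 = i := by rw [hf.var 13 rfl]; simpa [run] using h13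
    have o14 : (offer 14).eval t = w i (t.var 14) + s.arr 8 (t.var 14) := by
      simp only [offer, Expr.eval, e13, e2, e7, e8, hw i hi _ h1]
    have o9 : (offer 9).eval t = w i y + s.arr 8 y := by
      simp only [offer, Expr.eval, e13, e2, e7, e8, ht, hw i hi _ hy]
    have hs : ∀ j < y + 1, j < y ∨ j = y := fun j hj => Nat.lt_succ_iff_lt_or_eq.mp hj
    by_cases hc : (offer 14).eval t - (offer 9).eval t = 0
    · simp only [run, Expr.eval, hc, ne_eq, not_true_eq_false, if_false, State.setVar_var,
        Nat.reduceEqDiff]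
      rw [o14, o9] at hc
      refine ⟨h1, fun j hj => ?_⟩
      rcases hs j hj with h | rfl
      · exact h2 j h
      · omega
    · simp only [run, Expr.eval, hc, ne_eq, not_false_eq_true, if_true, State.setVar_var,
        Nat.reduceEqDiff, if_false, ht]
      rw [o14, o9] at hc
      refine ⟨hy, fun j hj => ?_⟩
      rcases hs j hj with h | rfl
      · have := h2 j h
        omega
      · exact le_rfl

/-- After `m` rounds, the auction is over, or the prices add up to at least `m`. -/
structure AuctionState (L k n o : ℕ) (w : ℕ → ℕ → ℕ) (m : ℕ) (s : State) : Prop where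
  env : Env L k n o s
  weights : ∀ i < k, ∀ j < n + k, s.arr 7 (i * (n + k) + j) = w i j
  inv : AuctionInv k (n + k) ((k + 1) * n) w (s.arr 8) (s.arr 9) (s.arr 10)
  progress : (∀ i < k, s.arr 10 (i + 1) ≠ 0) ∨ m ≤ ∑ j ∈ Finset.range (n + k), s.arr 8 j

variable {w : ℕ → ℕ → ℕ} {m : ℕ}

theorem AuctionState.setVar (h : AuctionState L k n o w m s) {x v : ℕ}
    (hx : (assign x (.const v)).keepsEnv = true) : AuctionState L k n o w m (s.setVar x v) :=
  ⟨h.env.run (p := assign x (.const v)) hx, h.weights, h.inv, h.progress⟩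

theorem AuctionState.round (h : AuctionState L k n o w m s)
    (hw : ∀ i < k, ∀ j < n + k, w i j ≤ (k + 1) * n) :
    AuctionState L k n o w (m + 1) (round.run s) := by
  rw [BProg.round, run]
  set t := pick.run s with ht
  have hp := pick_spec h.env
  rw [← ht] at hp
  have hf : Frame pick s t := frame_run pick s
  have henv : Env L k n o t := h.env.frame hf rfl
  have a7 : t.arr 7 = s.arr 7 := hf.arr 7 rfl
  have a8 : t.arr 8 = s.arr 8 := hf.arr 8 rfl
  have a9 : t.arr 9 = s.arr 9 := hf.arr 9 rfl
  have a10 : t.arr 10 = s.arr 10 := hf.arr 10 rfl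
  have hinv := h.inv
  have hwt := h.weights
  have hpr := h.progress
  rw [← a8, ← a9, ← a10] at hinv
  rw [← a7] at hwt
  rw [← a10] at hp hpr
  rw [← a8] at hpr
  rcases hp with ⟨h13, hall⟩ | ⟨h13, h0⟩
  · rw [run, if_neg (by simp [Expr.eval, henv.v1, h13]), run]
    exact ⟨henv, hwt, hinv, .inl hall⟩
  · rw [run, if_pos (by simp [Expr.eval, henv.v1]; omega), run]
    obtain ⟨hb1, hb2⟩ := best_spec henv h13 rfl hwt
    have hf' : Frame best t (best.run t) := frame_run best t
    set t' := best.run t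
    have henv' : Env L k n o t' := henv.frame hf' rfl
    have b7 : t'.arr 7 = t.arr 7 := hf'.arr 7 rfl
    have b8 : t'.arr 8 = t.arr 8 := hf'.arr 8 rfl
    have b9 : t'.arr 9 = t.arr 9 := hf'.arr 9 rfl
    have b10 : t'.arr 10 = t.arr 10 := hf'.arr 10 rfl
    have b13 : t'.var 13 = t.var 13 := hf'.var 13 rfl
    have key := hinv.bid (by omega) hw h13 h0 hb1 hb2
    refine ⟨henv'.run rfl, ?_, ?_, .inr ?_⟩
    · rw [run_arr rfl, b7]; exact hwt
    · simpa [bid, run, Expr.eval, b8, b9, b10, b13] using key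
    · have e : (bid.run t').arr 8 =
          Function.update (t.arr 8) (t'.var 14) (t.arr 8 (t'.var 14) + 1) := by
        simp [bid, run, Expr.eval, b8]
      rcases hpr with hall | hpr
      · exact absurd h0 (hall _ h13)
      · rw [e, Finset.sum_update_of_mem (Finset.mem_range.mpr hb1)]
        rw [← Finset.add_sum_erase _ _ (Finset.mem_range.mpr hb1), Finset.erase_eq] at hpr
        omega

/-- Applied to both of the nested loops, it yields `L * L` rounds. -/
theorem AuctionState.rep {x c : ℕ} {p : BProg}
    (h : AuctionState L k n o w m s) (hx : (assign x (.const 0)).keepsEnv = true)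
    (hp : ∀ m s, AuctionState L k n o w m s → AuctionState L k n o w (m + c) (p.run s)) :
    AuctionState L k n o w (m + L * c) ((BProg.rep x 0 p).run s) := by
  refine rep_inv (N := L) (fun i t => AuctionState L k n o w (m + i * c) t)
    (by simp [h.env.v0]) ?_ ?_
  · simpa using h.setVar hx
  · intro i t _ _ _ ih
    have := (hp _ _ ih).setVar (x := x) (v := i + 1) hx
    rwa [add_assoc, ← Nat.succ_mul] at this

/-- The auction gives the agents distinct columns, of nearly optimal total weight. -/
theorem auction_spec (h : Env L k n o s)
    (hs : ∀ i < k, ∀ j < n + k, s.arr 7 (i * (n + k) + j) = w i j)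
    (hw : ∀ i < k, ∀ j < n + k, w i j ≤ (k + 1) * n) :
    ∃ f : ℕ → ℕ, (∀ i < k, (auction.run s).arr 10 (i + 1) = f i + 1) ∧ (∀ i < k, f i < n + k) ∧
      Set.InjOn f (Finset.range k) ∧
      ∀ g : ℕ → ℕ, (∀ i < k, g i < n + k) → Set.InjOn g (Finset.range k) →
        ∑ i ∈ Finset.range k, w i (f i) ≤ (∑ i ∈ Finset.range k, w i (g i)) + k := by
  have hlt := h.lt
  let q : BProg := clear 8 (.const 0) ;; clear 9 (.const 0) ;; clear 10 (.const 0)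
  have e : auction.run s = (BProg.rep 15 0 (BProg.rep 16 0 BProg.round)).run (q.run s) := rfl
  have hq : AuctionState L k n o w 0 (q.run s) := by
    refine ⟨h.run rfl, ?_, AuctionInv.start ?_ ?_ ?_, .inr (Nat.zero_le _)⟩
    · rw [run_arr rfl]; exact hs
    · intro j hj
      simp only [q, run]
      rw [run_arr rfl, run_arr rfl, clear_spec (fun _ _ => rfl) (by rw [h.v0]; omega)]
    · intro j hj
      simp only [q, run]
      rw [run_arr rfl, clear_spec (fun _ _ => rfl) (by rw [run_var rfl, h.v0]; omega)]
    · intro j hj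
      simp only [q, run]
      rw [clear_spec (fun _ _ => rfl) (by rw [run_var rfl, run_var rfl, h.v0]; omega)]
  have hfin := hq.rep (x := 15) rfl fun m s h =>
    h.rep (x := 16) (c := 1) (p := BProg.round) rfl fun m s h => h.round hw
  rw [← e] at hfin
  set t := auction.run s
  have hall : ∀ i < k, t.arr 10 (i + 1) ≠ 0 := by
    rcases hfin.progress with h1 | h1
    · exact h1
    · exfalso
      have h2 := hfin.inv.sum_price_le
      -- If the auction were unfinished, the prices would add up to at least `L * L`. But there are
      -- `n + k < L` columns, each of price at most `(k + 1) * n + 1 ≤ L`.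
      have h3 : (n + k) * ((k + 1) * n + 1) ≤ (n + k) * L := Nat.mul_le_mul_left _ h.lt'
      have h4 : (n + k) * L < L * L := Nat.mul_lt_mul_of_pos_right (by omega) (by omega)
      simp only [mul_one, zero_add] at h1
      omega
  refine ⟨fun i => t.arr 10 (i + 1) - 1, fun i hi => ?_, fun i hi => ?_, ?_,
    fun g hg hinj => hfin.inv.near_optimal hall g hg hinj⟩
  · have := hall i hi
    simp only
    omega
  · have h1 := hall i hi
    have h2 := hfin.inv.asg_le i hi
    simp only
    omega
  · intro i hi i' hi' he
    have hi := Finset.mem_range.mp hi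
    have hi' := Finset.mem_range.mp hi'
    have h1 := hall i hi
    have h2 := hall i' hi'
    exact hfin.inv.injOn hall hi hi' (by simp only at he; omega)

end BProg

end RAM

/-! #### The cost matrix -/

namespace Dissat.PrefGraph

variable {n : ℕ} {G : PrefGraph n} {ℓ : ℕ} {p : ℕ → Fin n}

/-- The array `r` holds the costs of the first `t + 1` vertices of the path and of the columns
outside of it; in the current round all arcs before `(u, v)` in lexicographic order have been
processed. -/
structure Relaxed (G : PrefGraph n) (ℓ : ℕ) (p : ℕ → Fin n) (L t u v : ℕ) (r : ℕ → ℕ) : Prop where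
  outside : ∀ j < L, (∀ v ∈ G.verts, v.val ≠ j) → r j = G.verts.card
  inside : ∀ a ≤ ℓ, a ≤ t → r (p a) = a
  next : t + 1 ≤ ℓ → ((p t).val < u ∨ (p t).val = u ∧ (p (t + 1)).val < v) → r (p (t + 1)) = t + 1

/-- An arc leaving a settled vertex writes the correct value at its head, so settled entries survive
further updates. The arc leaving `p t` settles `p (t + 1)`. -/
theorem Relaxed.step (hp : PathEnum G ℓ p) {L t : ℕ} {u v : Fin n} {r r' : ℕ → ℕ}
    (h : Relaxed G ℓ p L t u v r)
    (hr : r' = if (u, v) ∈ G.arcs then Function.update r v (r u + 1) else r) :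
    Relaxed G ℓ p L t u (v + 1) r' := by
  by_cases harc : (u, v) ∈ G.arcs
  · rw [if_pos harc] at hr
    obtain ⟨a, ha, rfl, rfl⟩ := (hp.arc u v).mp harc
    subst hr
    have hne : ∀ b ≤ ℓ, ((p b).val = (p (a + 1)).val ↔ b = a + 1) := fun b hb =>
      ⟨fun e => hp.inj b hb (a + 1) ha (Fin.ext e), fun e => by rw [e]⟩
    refine ⟨fun j hj hj' => ?_, fun b hb hbt => ?_, fun htℓ hlex => ?_⟩
    · rw [Function.update_of_ne, h.outside j hj hj']
      exact fun e => hj' _ ((hp.mem _).mpr ⟨a + 1, ha, rfl⟩) e.symm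
    · simp only [Function.update_apply, hne b hb]
      split_ifs with e
      · rw [h.inside a ha.le (by omega), e]
      · exact h.inside b hb hbt
    · simp only [Function.update_apply, hne _ htℓ]
      split_ifs with e
      · rw [h.inside a ha.le (by omega)]
        omega
      · refine h.next htℓ ?_
        have h1 := (hne (t + 1) htℓ).not.mpr e
        omega
  · rw [if_neg harc] at hr
    subst hr
    refine ⟨h.outside, h.inside, fun htℓ hlex => h.next htℓ ?_⟩
    have h1 : ¬ ((p t).val = u ∧ (p (t + 1)).val = v) := fun ⟨e1, e2⟩ =>
      harc ((hp.arc u v).mpr ⟨t, htℓ, Fin.ext e1, Fin.ext e2⟩)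
    omega

theorem Relaxed.next_tail {L t u : ℕ} {r : ℕ → ℕ} (h : Relaxed G ℓ p L t u n r) :
    Relaxed G ℓ p L t (u + 1) 0 r :=
  ⟨h.outside, h.inside, fun htℓ hlex => h.next htℓ (by have := (p (t + 1)).2; omega)⟩

theorem Relaxed.next_round {L t : ℕ} {r : ℕ → ℕ} (h : Relaxed G ℓ p L t n 0 r) :
    Relaxed G ℓ p L (t + 1) 0 0 r := by
  refine ⟨h.outside, fun a ha hat => ?_, fun _ hlex => by omega⟩
  rcases Nat.lt_succ_iff_lt_or_eq.mp (Nat.lt_succ_of_le hat) with h1 | rfl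
  · exact h.inside a ha (by omega)
  · exact h.next ha (.inl (p t).2)

theorem Relaxed.eq_cost (hp : PathEnum G ℓ p) {L : ℕ} {r : ℕ → ℕ}
    (h : Relaxed G ℓ p L n 0 0 r) {j : ℕ} (hj : j < L) : r j = G.cost j := by
  by_cases hm : ∀ v ∈ G.verts, v.val ≠ j
  · rw [h.outside j hj hm, G.cost_of_notMem hm]
  · push Not at hm
    obtain ⟨v, hv, rfl⟩ := hm
    obtain ⟨a, ha, rfl⟩ := (hp.mem v).mp hv
    -- A path has fewer than `n` arcs, so `n` rounds settle all its vertices.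
    rw [hp.cost_eq ha, h.inside a ha (by have := hp.length_lt; omega)]

end Dissat.PrefGraph

namespace RAM

open Dissat

/-- The array `A` holds the graphs of the profile from position `o + 2` on. -/
structure HoldsGraphs (I : Profile) (o : ℕ) (A : ℕ → ℕ) : Prop where
  mem : ∀ (i : Fin I.k) (v : Fin I.n),
    A (o + 2 + i * (I.n + I.n * I.n) + v) = if v ∈ (I.graph i).verts then 1 else 0
  adj : ∀ (i : Fin I.k) (u v : Fin I.n), A (o + 2 + i * (I.n + I.n * I.n) + I.n + u * I.n + v) =
    if (u, v) ∈ (I.graph i).arcs then 1 else 0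

namespace BProg

/-- The membership bit of vertex `var 9` for agent `var 8`. -/
def memBit : Expr := .read 0 (.add (.add (.var 20) (.read 3 (.var 8))) (.var 9))

/-- The adjacency bit of the pair `(var 10, var 9)` for agent `var 8`. -/
def adjBit : Expr :=
  .read 0 (.add (.add (.add (.add (.var 20) (.read 3 (.var 8))) (.var 2)) (.read 1 (.var 10)))
    (.var 9))

/-- Set the cost of the vertices to `0`, and of the other columns to the number of vertices. -/
def initCosts : BProg :=
  accum 12 9 2 memBit ;; clear 5 (.var 12) ;; rep 9 2 (ite memBit (write 5 (.var 9) (.const 0)) skip)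

/-- Propagate the costs along the arcs. -/
def relaxCosts : BProg :=
  rep 11 2 (rep 10 2 (rep 9 2
    (ite adjBit (write 5 (.var 9) (.add (.read 5 (.var 10)) (.const 1))) skip)))

def costs : BProg := rep 8 1 (initCosts ;; relaxCosts ;; fillRow 6 2 3 (.read 5 (.var 9)))

variable {I : Profile} {L o : ℕ} {s : State}

theorem eval_memBit (h : Env L I.k I.n o s) (hA : HoldsGraphs I o (s.arr 0)) {i : Fin I.k}
    (h8 : s.var 8 = i) {v : Fin I.n} (h9 : s.var 9 = v) :
    memBit.eval s = if v ∈ (I.graph i).verts then 1 else 0 := by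
  have := h.lt
  rw [← hA.mem i v]
  simp only [memBit, Expr.eval, h.v20, h8, h9, h.a3 i (by omega)]

theorem eval_adjBit (h : Env L I.k I.n o s) (hA : HoldsGraphs I o (s.arr 0)) {i : Fin I.k}
    (h8 : s.var 8 = i) {u v : Fin I.n} (h10 : s.var 10 = u) (h9 : s.var 9 = v) :
    adjBit.eval s = if (u, v) ∈ (I.graph i).arcs then 1 else 0 := by
  have := h.lt
  rw [← hA.adj i u v]
  simp only [adjBit, Expr.eval, h.v20, h.v2, h8, h9, h10, h.a3 i (by omega), h.a1 u (by omega)]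

/-- Of the initial zeros only the one at the source has to be right, and no arc ever overwrites it.
-/
theorem initCosts_spec (h : Env L I.k I.n o s) (hA : HoldsGraphs I o (s.arr 0)) {i : Fin I.k}
    (h8 : s.var 8 = i) {ℓ : ℕ} {p : ℕ → Fin I.n} (hp : (I.graph i).PathEnum ℓ p) :
    (I.graph i).Relaxed ℓ p L 0 0 0 ((initCosts.run s).arr 5) := by
  have hlt := h.lt
  simp only [initCosts, run]
  have hcard : ((accum 12 9 2 memBit).run s).var 12 = (I.graph i).verts.card := by
    rw [accum_spec (fun j => if hj : j < I.n then
      (if (⟨j, hj⟩ : Fin I.n) ∈ (I.graph i).verts then 1 else 0) else 0) (by simp) (by simp)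
      (by simp) h.min2]
    · simp [Finset.sum_range]
    · intro j t hj h9 hf
      simp only [hj, dif_pos]
      exact eval_memBit (h.frame hf rfl) (by rw [hf.arr 0 rfl]; exact hA)
        (by rw [hf.var 8 rfl, h8]) (v := ⟨j, hj⟩) h9
  set s₁ := (accum 12 9 2 memBit).run s with hs₁
  have hf₁ : Frame (accum 12 9 2 memBit) s s₁ := frame_run _ _
  have henv₁ : Env L I.k I.n o s₁ := h.frame hf₁ rfl
  have hclear : ∀ x < L, ((clear 5 (.var 12)).run s₁).arr 5 x = (I.graph i).verts.card :=
    fun x hx => clear_spec (e := .var 12) (fun t hf => (hf.var 12 rfl).trans hcard) (by rwa [henv₁.v0])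
  set s₂ := (clear 5 (.var 12)).run s₁ with hs₂
  have hf₂ : Frame (clear 5 (.var 12)) s₁ s₂ := frame_run _ _
  have henv₂ : Env L I.k I.n o s₂ := henv₁.frame hf₂ rfl
  have key := rep_inv (p := ite memBit (write 5 (.var 9) (.const 0)) skip) (s := s₂) (x := 9)
    (N := I.n) (fun y t => (∀ j < L, (∀ v ∈ (I.graph i).verts, v.val ≠ j) →
      t.arr 5 j = (I.graph i).verts.card) ∧
      ∀ v ∈ (I.graph i).verts, v.val < y → t.arr 5 v = 0) henv₂.min2
    ⟨fun j hj _ => hclear j hj, fun _ _ hv => absurd hv (Nat.not_lt_zero _)⟩ ?_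
  · refine ⟨key.1, fun a ha h0 => ?_, fun _ hlex => by omega⟩
    obtain rfl : a = 0 := by omega
    exact key.2 _ ((hp.mem _).mpr ⟨0, ha, rfl⟩) (p 0).2
  · intro y t hy h9 hf ⟨h1, h2⟩
    have hb := eval_memBit (henv₂.frame hf rfl)
      (by rw [hf.arr 0 rfl, hf₂.arr 0 rfl, hf₁.arr 0 rfl]; exact hA) (i := i)
      (by rw [hf.var 8 rfl, hf₂.var 8 rfl, hf₁.var 8 rfl, h8]) (v := ⟨y, hy⟩) h9
    by_cases hm : (⟨y, hy⟩ : Fin I.n) ∈ (I.graph i).verts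
    · simp only [run, hb, hm, if_true, ne_eq, one_ne_zero, not_false_eq_true, State.setVar_arr,
        State.setArr_arr, Expr.eval, h9, Function.update_apply]
      constructor
      · intro j hj hj'
        rw [if_neg (fun e => hj' _ hm e.symm), h1 j hj hj']
      · intro v hv hvy
        split_ifs with e
        · rfl
        · exact h2 v hv (by omega)
    · simp only [run, hb, hm, if_false, ne_eq, not_true_eq_false, State.setVar_arr]
      refine ⟨h1, fun v hv hvy => h2 v hv ?_⟩
      have : v.val ≠ y := fun e => hm (by subst e; exact hv)
      omega

theorem relaxCosts_spec (h : Env L I.k I.n o s) (hA : HoldsGraphs I o (s.arr 0)) {i : Fin I.k}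
    (h8 : s.var 8 = i) {ℓ : ℕ} {p : ℕ → Fin I.n} (hp : (I.graph i).PathEnum ℓ p)
    (hr : (I.graph i).Relaxed ℓ p L 0 0 0 (s.arr 5)) :
    (I.graph i).Relaxed ℓ p L I.n 0 0 ((relaxCosts.run s).arr 5) := by
  refine rep_inv (N := I.n) (fun t s => (I.graph i).Relaxed ℓ p L t 0 0 (s.arr 5)) h.min2 hr ?_
  intro t s₁ ht _ hf₁ hr₁
  have henv₁ := h.frame hf₁ rfl
  refine PrefGraph.Relaxed.next_round ?_
  refine rep_inv (N := I.n) (s := s₁)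
    (fun u s => (I.graph i).Relaxed ℓ p L t u 0 (s.arr 5)) henv₁.min2 hr₁ ?_
  intro u s₂ hu h10 hf₂ hr₂
  have henv₂ := henv₁.frame hf₂ rfl
  refine PrefGraph.Relaxed.next_tail ?_
  refine rep_inv (N := I.n) (s := s₂)
    (fun v s => (I.graph i).Relaxed ℓ p L t u v (s.arr 5)) henv₂.min2 hr₂ ?_
  intro v s₃ hv h9 hf₃ hr₃
  refine PrefGraph.Relaxed.step hp (u := ⟨u, hu⟩) (v := ⟨v, hv⟩) hr₃ ?_
  have h10' : s₃.var 10 = u := by rw [hf₃.var 10 rfl, h10]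
  have hb := eval_adjBit (henv₂.frame hf₃ rfl)
    (by rw [hf₃.arr 0 rfl, hf₂.arr 0 rfl, hf₁.arr 0 rfl]; exact hA) (i := i)
    (by rw [hf₃.var 8 rfl, hf₂.var 8 rfl, hf₁.var 8 rfl, h8])
    (u := ⟨u, hu⟩) (v := ⟨v, hv⟩) h10' h9
  by_cases hm : ((⟨u, hu⟩ : Fin I.n), (⟨v, hv⟩ : Fin I.n)) ∈ (I.graph i).arcs
  · simp [run, hb, hm, Expr.eval, h9, h10']
  · simp [run, hb, hm]

end BProg

end RAM

namespace Dissat.Profile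

/-- The cost matrix, indexed by natural numbers. -/
noncomputable def cost (I : Profile) (i j : ℕ) : ℕ :=
  if h : i < I.k then (I.graph ⟨i, h⟩).cost j else 0

theorem cost_le (I : Profile) (i j : ℕ) : I.cost i j ≤ I.n := by
  unfold cost
  split_ifs
  · exact PrefGraph.cost_le _ _
  · exact Nat.zero_le _

@[simp] theorem cost_fin (I : Profile) (i : Fin I.k) (j : ℕ) :
    I.cost i j = (I.graph i).cost j := by
  simp [cost]

end Dissat.Profile

namespace RAM.BProg

open Dissat

variable {I : Profile} {L o : ℕ} {s : State}

theorem costs_spec (hI : I.AllPaths) (h : Env L I.k I.n o s) (hA : HoldsGraphs I o (s.arr 0)) :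
    ∀ i < I.k, ∀ j < I.n + I.k, (costs.run s).arr 6 (i * (I.n + I.k) + j) = I.cost i j := by
  have hlt := h.lt
  refine rows_spec I.cost h.min1 fun i t hi h8 hf => ?_
  obtain ⟨ℓ, p, hp⟩ := (hI ⟨i, hi⟩).exists_pathEnum
  have henv := h.frame hf rfl
  have hA' : HoldsGraphs I o (t.arr 0) := by rw [hf.arr 0 rfl]; exact hA
  have h1 := initCosts_spec henv hA' (i := ⟨i, hi⟩) h8 hp
  have hf₁ : Frame initCosts t (initCosts.run t) := frame_run _ _
  simp only [run]
  set t₁ := initCosts.run t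
  have h2 := relaxCosts_spec (henv.frame hf₁ rfl) (by rw [hf₁.arr 0 rfl]; exact hA')
    (i := ⟨i, hi⟩) (by rw [hf₁.var 8 rfl, h8]) hp h1
  have hf₂ : Frame relaxCosts t₁ (relaxCosts.run t₁) := frame_run _ _
  set t₂ := relaxCosts.run t₁
  have henv₂ := (henv.frame hf₁ rfl).frame hf₂ rfl
  have h8' : t₂.var 8 = i := by rw [hf₂.var 8 rfl, hf₁.var 8 rfl, h8]
  have hrow : t₂.arr 2 (t₂.var 8) = i * (I.n + I.k) := by rw [h8']; exact henv₂.a2 i (by omega)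
  have key := fillRow_spec (a := 6) (τ := 2) (b := 3) (e := .read 5 (.var 9)) (s := t₂)
    (N := I.n + I.k) (I.cost i) (by simp) henv₂.min3 fun j t' hj h9 hf' => ?_
  · rw [hrow] at key
    refine ⟨key.1, fun x hx => ?_⟩
    rw [key.2 x hx, hf₂.arr 6 rfl, hf₁.arr 6 rfl]
  · simp only [Expr.eval, h9, hf'.arr 5 rfl, Profile.cost, hi, dif_pos]
    exact h2.eq_cost hp (by omega)

end RAM.BProg

namespace RAM.BProg

/-! #### Solving the assignment problems -/

/-- The cost matrix is available. -/
structure Ready (L k n o : ℕ) (c : ℕ → ℕ → ℕ) (s : State) : Prop where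
  env : Env L k n o s
  cell : ∀ i < k, ∀ j < n + k, s.arr 6 (i * (n + k) + j) = c i j
  le : ∀ i < k, ∀ j < n + k, c i j ≤ n

/-- The agents get the distinct columns `f`. -/
structure Columns (k n : ℕ) (f : ℕ → ℕ) : Prop where
  lt : ∀ i < k, f i < n + k
  inj : Set.InjOn f (Finset.range k)

variable {L k n o : ℕ} {c : ℕ → ℕ → ℕ} {s t : State} {f : ℕ → ℕ}

theorem Ready.frame {p : BProg} (h : Ready L k n o c s) (hf : Frame p s t)
    (hp : p.keepsEnv = true) (h6 : p.modA.contains 6 = false) : Ready L k n o c t :=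
  ⟨h.env.frame hf hp, by rw [hf.arr 6 h6]; exact h.cell, h.le⟩

theorem Ready.run {p : BProg} (h : Ready L k n o c s)
    (hp : p.keepsEnv = true) (h6 : p.modA.contains 6 = false) : Ready L k n o c (p.run s) :=
  h.frame (frame_run p s) hp h6

/-- The cost of column `var 9` for agent `var 8`. -/
def costCell : Expr := .read 6 (.add (.read 2 (.var 8)) (.var 9))

/-- The amount by which the cost of agent `var 8` exceeds `e`. -/
def excess (e : Expr) : Expr :=
  .sub (.read 6 (.add (.read 2 (.var 8))
    (.sub (.read 10 (.add (.var 8) (.const 1))) (.const 1)))) e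

/-- With `e = 0` this is the total cost; with `e` a threshold it vanishes iff all agents meet the
threshold. -/
def totalExcess (e : Expr) : BProg := accum 19 8 1 (excess e)

def minSum : BProg := fill 7 2 3 (.read 4 costCell) ;; auction

/-- Search for columns of cost at most `var 17`, and increase that threshold if there are none. -/
def minMaxRound : BProg :=
  fill 7 2 3 (.read 4 (.sub (.const 1) (.sub (.const 1) (.sub costCell (.var 17))))) ;;
  auction ;;
  totalExcess (.var 17) ;;
  ite (.var 19) (assign 17 (.add (.var 17) (.const 1))) skip

def minMax : BProg := assign 17 (.const 0) ;; rep 18 0 minMaxRound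

theorem Ready.eval_costCell (h : Ready L k n o c s) {i j : ℕ} (hi : i < k) (hj : j < n + k)
    (h8 : s.var 8 = i) (h9 : s.var 9 = j) : costCell.eval s = c i j := by
  have := h.env.lt
  simp only [costCell, Expr.eval, h8, h9, h.env.a2 i (by omega), h.cell i hi j hj]

theorem totalExcess_spec (h : Ready L k n o c s) (hc : Columns k n f)
    (hs : ∀ i < k, s.arr 10 (i + 1) = f i + 1) {e : Expr} {d : ℕ}
    (he : ∀ t, Frame (totalExcess e) s t → e.eval t = d) :
    ((totalExcess e).run s).var 19 = ∑ i ∈ Finset.range k, (c i (f i) - d) := by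
  refine accum_spec (fun i => c i (f i) - d) (by simp) (by simp) (by simp) h.env.min1
    fun i t hi h8 hf => ?_
  have hR := h.frame hf rfl rfl
  have := h.env.lt
  simp only [excess, Expr.eval, h8, he t hf, hR.env.a2 i (by omega), hf.arr 10 rfl, hs i hi,
    Nat.add_sub_cancel, hR.cell i hi _ (hc.lt i hi)]

/-- Setting up weights that are multiples of `k + 1`, and running the auction. -/
theorem fill_auction_spec (h : Ready L k n o c s) {e : Expr} (m : ℕ → ℕ → ℕ)
    (he : ∀ i j t, i < k → j < n + k → t.var 8 = i → t.var 9 = j →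
      Frame (fill 7 2 3 (.read 4 e)) s t → e.eval t = m i j)
    (hm : ∀ i < k, ∀ j < n + k, m i j ≤ n) :
    ∃ f, Columns k n f ∧
      (∀ i < k, (auction.run ((fill 7 2 3 (.read 4 e)).run s)).arr 10 (i + 1) = f i + 1) ∧
      ∀ g, Columns k n g →
        ∑ i ∈ Finset.range k, m i (f i) ≤ ∑ i ∈ Finset.range k, m i (g i) := by
  have hlt := h.env.lt
  have hfill := fill_spec (a := 7) (τ := 2) (b := 3) (e := .read 4 e) (s := s)
    (fun i j => m i j * (k + 1)) (by simp) (by simp) (by simp) h.env.min1 h.env.min3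
    (fun i hi => h.env.a2 i (by omega)) fun i j t hi hj h8 h9 hf => by
      have := hm i hi j hj
      simp only [Expr.eval, he i j t hi hj h8 h9 hf]
      exact (h.env.frame hf rfl).a4 _ (by omega)
  obtain ⟨f, h1, h2, h3, h4⟩ := auction_spec (h.env.run rfl) hfill fun i hi j hj => by
    rw [mul_comm]
    exact Nat.mul_le_mul_left _ (hm i hi j hj)
  refine ⟨f, ⟨h2, h3⟩, h1, fun g hg => ?_⟩
  have := h4 g hg.lt hg.inj
  rw [← Finset.sum_mul, ← Finset.sum_mul] at this
  -- All totals are multiples of `k + 1`, so a smaller total would be smaller by at least `k + 1`,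
  -- while the auction loses at most `k`.
  by_contra hlt
  have h5 := Nat.mul_le_mul_right (k + 1) (Nat.succ_le_of_lt (not_le.mp hlt))
  rw [Nat.succ_mul] at h5
  omega

theorem minSum_spec (h : Ready L k n o c s) :
    ∃ f, Columns k n f ∧ (∀ i < k, (minSum.run s).arr 10 (i + 1) = f i + 1) ∧
      ∀ g, Columns k n g →
        ∑ i ∈ Finset.range k, c i (f i) ≤ ∑ i ∈ Finset.range k, c i (g i) := by
  rw [minSum, BProg.run]
  exact fill_auction_spec h c
    (fun _ _ _ hi hj h8 h9 hf => (h.frame hf rfl rfl).eval_costCell hi hj h8 h9) h.le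

theorem minMaxRound_spec (h : Ready L k n o c s) :
    ∃ f, Columns k n f ∧ (∀ i < k, (minMaxRound.run s).arr 10 (i + 1) = f i + 1) ∧
      (((minMaxRound.run s).var 17 = s.var 17 ∧ ∀ i < k, c i (f i) ≤ s.var 17) ∨
        ((minMaxRound.run s).var 17 = s.var 17 + 1 ∧
          ∀ g, Columns k n g → ∃ i < k, s.var 17 < c i (g i))) := by
  obtain ⟨f, hf, hs, hopt⟩ := fill_auction_spec h
    (e := .sub (.const 1) (.sub (.const 1) (.sub costCell (.var 17))))
    -- This is the indicator of `s.var 17 < c i j`, so the auction minimizes the number of agents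
    -- above the threshold.
    (fun i j => 1 - (1 - (c i j - s.var 17))) (fun i j t hi hj h8 h9 hfr => by
      simp only [Expr.eval, (h.frame hfr rfl rfl).eval_costCell hi hj h8 h9, hfr.var 17 rfl])
    fun i hi j hj => by
      have := h.le i hi j hj
      omega
  simp only [minMaxRound, BProg.run]
  have hf₁ := frame_run (fill 7 2 3
    (.read 4 (.sub (.const 1) (.sub (.const 1) (.sub costCell (.var 17)))))) s
  generalize (fill 7 2 3
    (.read 4 (.sub (.const 1) (.sub (.const 1) (.sub costCell (.var 17)))))).run s = s₁ at hs hf₁ ⊢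
  have hf₂ := frame_run auction s₁
  generalize auction.run s₁ = s₂ at hs hf₂ ⊢
  have h17 : s₂.var 17 = s.var 17 := by rw [hf₂.var 17 rfl, hf₁.var 17 rfl]
  have hR := (h.frame hf₁ rfl rfl).frame hf₂ rfl rfl
  have htot := totalExcess_spec hR hf hs (e := .var 17) (d := s.var 17) fun t ht => by
    rw [Expr.eval, ht.var 17 rfl, h17]
  have hf₃ := frame_run (totalExcess (.var 17)) s₂
  generalize (totalExcess (.var 17)).run s₂ = s₃ at htot hf₃ ⊢
  have h17' : s₃.var 17 = s.var 17 := by rw [hf₃.var 17 rfl, h17]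
  refine ⟨f, hf, fun i hi => ?_, ?_⟩
  · rw [← hs i hi, ← hf₃.arr 10 rfl]
    split_ifs <;> rfl
  · by_cases h0 : ∑ i ∈ Finset.range k, (c i (f i) - s.var 17) = 0
    · left
      simp only [Expr.eval, htot, h0, ne_eq, not_true_eq_false, if_false, h17', true_and]
      intro i hi
      have := (Finset.sum_eq_zero_iff.mp h0) i (Finset.mem_range.mpr hi)
      omega
    · right
      simp only [Expr.eval, htot, h0, ne_eq, not_false_eq_true, if_true, State.setVar_var, h17',
        true_and]
      intro g hg
      by_contra! hle
      have h1 := hopt g hg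
      have h2 : ∑ i ∈ Finset.range k, (1 - (1 - (c i (g i) - s.var 17))) = 0 :=
        Finset.sum_eq_zero fun i hi => by
          have := hle i (Finset.mem_range.mp hi)
          omega
      refine h0 (Finset.sum_eq_zero fun i hi => ?_)
      have h3 := (Finset.sum_eq_zero_iff.mp (Nat.le_zero.mp (h1.trans_eq h2))) i hi
      omega

theorem minMax_spec (h : Ready L k n o c s) :
    ∃ f, Columns k n f ∧ (∀ i < k, (minMax.run s).arr 10 (i + 1) = f i + 1) ∧
      (∀ i < k, c i (f i) ≤ (minMax.run s).var 17) ∧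
      ∀ g D, Columns k n g → (∀ i < k, c i (g i) ≤ D) → (minMax.run s).var 17 ≤ D := by
  have h₀ : Ready L k n o c ((assign 17 (.const 0)).run s) := h.run rfl rfl
  have key := rep_inv (p := minMaxRound) (x := 18) (b := 0) (s := (assign 17 (.const 0)).run s)
    -- The threshold never passes a feasible value. After `r` rounds either all of them failed, or
    -- the current columns meet the threshold.
    (N := L) (fun r t =>
      (∀ g D, Columns k n g → (∀ i < k, c i (g i) ≤ D) → t.var 17 ≤ D) ∧
      (t.var 17 = r ∨ ∃ f, Columns k n f ∧ (∀ i < k, t.arr 10 (i + 1) = f i + 1) ∧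
        ∀ i < k, c i (f i) ≤ t.var 17)) (by simp [h₀.env.v0])
    (by simp [BProg.run, Expr.eval]) ?_
  · change _ ∧ ((minMax.run s).var 17 = L ∨ ∃ f, Columns k n f ∧
      (∀ i < k, (minMax.run s).arr 10 (i + 1) = f i + 1) ∧
        ∀ i < k, c i (f i) ≤ (minMax.run s).var 17) at key
    obtain ⟨hmin, hL | ⟨f, hf, h1, h2⟩⟩ := key
    · have hlt := h.env.lt
      -- Giving column `i` to agent `i` shows that threshold `n < L` is feasible, so not all `L`
      -- rounds can fail.
      have := hmin id n ⟨fun i hi => by simp only [id]; omega, Function.injective_id.injOn⟩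
        fun i hi => h.le i hi _ (by simp only [id]; omega)
      change (minMax.run s).var 17 ≤ n at this
      omega
    · exact ⟨f, hf, h1, h2, hmin⟩
  · intro r t hr _ hfr ⟨hmin, hold⟩
    obtain ⟨f, hf, hs, hres⟩ := minMaxRound_spec (h₀.frame hfr rfl rfl)
    simp only [State.setVar_var, State.setVar_arr, Nat.reduceEqDiff, if_false]
    rcases hres with ⟨h17, hle⟩ | ⟨h17, hno⟩
    · rw [h17]
      exact ⟨hmin, .inr ⟨f, hf, hs, hle⟩⟩
    · rw [h17]
      refine ⟨fun g D hg hD => ?_, .inl ?_⟩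
      · obtain ⟨i, hi, hlt⟩ := hno g hg
        exact hlt.trans_le (hD i hi)
      -- A round cannot fail after a successful one, because the threshold is then already feasible.
      · rcases hold with h1 | ⟨f', hf', -, hle⟩
        · rw [h1]
        · obtain ⟨i, hi, hlt⟩ := hno f' hf'
          exact absurd (hle i hi) (not_le.mpr hlt)

end RAM.BProg

/-! ### The encodings -/

section Lists

variable {α : Type*}

theorem List.length_flatMap_of_length_eq {l : List α} {f : α → List ℕ} {m : ℕ}
    (hf : ∀ a ∈ l, (f a).length = m) : (l.flatMap f).length = l.length * m := by
  rw [List.length_flatMap, List.map_congr_left hf]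
  simp

theorem List.getD_flatMap_of_length_eq {l : List α} {f : α → List ℕ} {m : ℕ}
    (hf : ∀ a ∈ l, (f a).length = m) {i j : ℕ} (hi : i < l.length) (hj : j < m) :
    (l.flatMap f).getD (i * m + j) 0 = (f l[i]).getD j 0 := by
  induction l generalizing i with
  | nil => simp at hi
  | cons a l ih =>
    have ha : (f a).length = m := hf a (by simp)
    rw [List.flatMap_cons]
    cases i with
    | zero => rw [zero_mul, zero_add, List.getD_append _ _ _ _ (by omega)]; rfl
    | succ i =>
      rw [List.getD_append_right _ _ _ _ (by rw [Nat.succ_mul]; omega),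
        show (i + 1) * m + j - (f a).length = i * m + j by rw [Nat.succ_mul]; omega]
      exact ih (fun b hb => hf b (by simp [hb])) (by simpa using hi)

theorem List.getD_map_finRange {n : ℕ} (g : Fin n → ℕ) (v : Fin n) :
    ((List.finRange n).map g).getD v 0 = g v := by
  rw [List.getD_eq_getElem _ _ (by simp)]
  simp

end Lists

namespace Dissat.Profile

open RAM

theorem length_encode (I : Profile) : I.encode.length = 2 + I.k * (I.n + I.n * I.n) := by
  have h : ∀ i ∈ List.finRange I.k,
      (((List.finRange I.n).map fun v => if v ∈ (I.graph i).verts then 1 else 0) ++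
      (List.finRange I.n).flatMap fun u =>
        (List.finRange I.n).map fun v => if (u, v) ∈ (I.graph i).arcs then 1 else 0).length =
      I.n + I.n * I.n := fun i _ => by
    rw [List.length_append, List.length_flatMap_of_length_eq (m := I.n) (by simp)]
    simp
  rw [encode, List.length_append, List.length_flatMap_of_length_eq h]
  simp

theorem getD_encode (I : Profile) (i : Fin I.k) {x : ℕ} (hx : x < I.n + I.n * I.n) :
    I.encode.getD (2 + (i * (I.n + I.n * I.n) + x)) 0 =
      (((List.finRange I.n).map fun v => if v ∈ (I.graph i).verts then 1 else 0) ++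
      (List.finRange I.n).flatMap fun u =>
        (List.finRange I.n).map fun v => if (u, v) ∈ (I.graph i).arcs then 1 else 0).getD x 0 := by
  rw [encode, List.getD_append_right _ _ _ _ (by simp)]
  simp only [List.length_cons, List.length_nil, zero_add, Nat.reduceAdd, Nat.add_sub_cancel_left]
  rw [List.getD_flatMap_of_length_eq (m := I.n + I.n * I.n) _ (by simp) hx]
  · simp
  · intro i _
    rw [List.length_append, List.length_flatMap_of_length_eq (m := I.n) (by simp)]
    simp

theorem holdsGraphs_of_encode (I : Profile) {o : ℕ} {A : ℕ → ℕ}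
    (hA : ∀ x, A (o + x) = I.encode.getD x 0) : HoldsGraphs I o A where
  mem i v := by
    have := v.2
    rw [show o + 2 + i * (I.n + I.n * I.n) + v = o + (2 + (i * (I.n + I.n * I.n) + v)) by omega,
      hA, getD_encode I i (by omega), List.getD_append _ _ _ _ (by simp), List.getD_map_finRange]
  adj i u v := by
    have h1 : (u + 1) * I.n ≤ I.n * I.n := Nat.mul_le_mul_right _ u.2
    rw [Nat.succ_mul] at h1
    have := v.2
    rw [show o + 2 + i * (I.n + I.n * I.n) + I.n + u * I.n + v =
        o + (2 + (i * (I.n + I.n * I.n) + (I.n + (u * I.n + v)))) by omega,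
      hA, getD_encode I i (by omega), List.getD_append_right _ _ _ _ (by simp)]
    simp only [List.length_map, List.length_finRange, Nat.add_sub_cancel_left]
    rw [List.getD_flatMap_of_length_eq (m := I.n) (by simp) (by simp) v.2, List.getD_map_finRange]
    simp

theorem Allocation.encode_eq {I : Profile} (π : I.Allocation) {A : ℕ → ℕ}
    (hA : ∀ (i : Fin I.k) (v : Fin I.n), A (i * I.n + v) = if v ∈ π.bundle i then 1 else 0) :
    (List.range (I.k * I.n)).map A = π.encode := by
  have hlen : ∀ i ∈ List.finRange I.k, ((List.finRange I.n).map
      fun v => if v ∈ π.bundle i then 1 else 0).length = I.n := by simp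
  refine List.ext_getElem ?_ fun x hx hx' => ?_
  · rw [encode, List.length_flatMap_of_length_eq hlen]
    simp
  · have hx1 : x < I.k * I.n := by simpa using hx
    have hn : 0 < I.n := Nat.pos_of_ne_zero fun h => by simp [h] at hx1
    have hi : x / I.n < I.k := (Nat.div_lt_iff_lt_mul hn).mpr hx1
    have hj : x % I.n < I.n := Nat.mod_lt _ hn
    have e : x = x / I.n * I.n + x % I.n := (Nat.div_add_mod' x I.n).symm
    have h1 := hA ⟨x / I.n, hi⟩ ⟨x % I.n, hj⟩
    simp only [← e] at h1
    rw [List.getElem_map, List.getElem_range, h1, ← List.getD_eq_getElem _ 0 hx', encode]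
    conv_rhs => rw [e]
    rw [List.getD_flatMap_of_length_eq hlen (by simpa using hi) hj]
    exact ((List.getD_map_finRange _ ⟨x % I.n, hj⟩).trans (by simp)).symm

end Dissat.Profile

namespace RAM.BProg

open Dissat

/-! ### The polynomial-time algorithms -/

def setup (o : ℕ) : BProg := readHeader o ;; costs

theorem setup_spec {I : Profile} (hI : I.AllPaths) {o : ℕ} {w : List ℕ}
    (hlen : w.length = o + I.encode.length) (hw : ∀ x, w.getD (o + x) 0 = I.encode.getD x 0) :
    ∃ n, (I.k ≠ 0 → n = I.n) ∧
      Ready w.length I.k n o I.cost ((setup o).run (State.start w)) := by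
  have hk : (State.start w).arr 0 o = I.k := hw 0
  have hn : (State.start w).arr 0 (o + 1) = I.n := hw 1
  rw [I.length_encode] at hlen
  rw [setup, run]
  by_cases h0 : I.k = 0
  · rw [h0] at hlen hk ⊢
    have henv := readHeader_spec (n := 0) hk (by simp) (by simp [State.start, hlen])
      (by simp [State.start, hlen])
    exact ⟨0, fun h => absurd rfl h, Env.run (p := costs) henv rfl, by simp, by simp⟩
  · have hpos : 0 < I.n := by
      obtain ⟨ℓ, p, -⟩ := hI ⟨0, Nat.pos_of_ne_zero h0⟩
      exact (p 0).pos
    have hk1 : 1 ≤ I.k := Nat.pos_of_ne_zero h0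
    have e1 : I.k * (I.n + I.n * I.n) = I.k * I.n + I.k * (I.n * I.n) := by ring
    have e2 : (I.k + 1) * I.n = I.k * I.n + I.n := by ring
    have h1 : I.k ≤ I.k * I.n := Nat.le_mul_of_pos_right _ hpos
    have h2 : I.n ≤ I.n * I.n := Nat.le_mul_of_pos_right _ hpos
    have h3 : I.n * I.n ≤ I.k * (I.n * I.n) := Nat.le_mul_of_pos_left _ hk1
    have henv : Env w.length I.k I.n o ((readHeader o).run (State.start w)) :=
      readHeader_spec hk (by rw [if_neg h0, hn]) (by simp [State.start, hlen]; omega)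
        (by simp [State.start, hlen]; omega)
    refine ⟨I.n, fun _ => rfl, henv.run (p := costs) rfl, ?_, fun i _ j _ => I.cost_le i j⟩
    refine costs_spec hI henv (I.holdsGraphs_of_encode fun x => ?_)
    rw [run_arr rfl]
    exact hw x

/-- Write the incidence matrix of the allocation. -/
def writeAllocation : BProg :=
  -- The two truncated differences add up to the distance, so the entry is `1` iff the agent holds
  -- this column. Rows have length `n`, so a dummy column leaves a zero row.
  fill 0 1 2 (.sub (.const 1) (.add
    (.sub (.read 10 (.add (.var 8) (.const 1))) (.add (.var 9) (.const 1)))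
    (.sub (.add (.var 9) (.const 1)) (.read 10 (.add (.var 8) (.const 1))))))

theorem writeAllocation_spec {I : Profile} {L n o : ℕ} {c : ℕ → ℕ → ℕ} {s : State} {f : ℕ → ℕ}
    (hn : I.k ≠ 0 → n = I.n) (h : Ready L I.k n o c s)
    (hinj : Set.InjOn f (Finset.range I.k)) (hs : ∀ i < I.k, s.arr 10 (i + 1) = f i + 1) :
    (List.range ((Expr.read 1 (.var 1)).eval (writeAllocation.run s))).map
      ((writeAllocation.run s).arr 0) = (I.ofColumns f hinj).encode := by
  have hlt := h.env.lt
  have hE : Env L I.k n o (writeAllocation.run s) := h.env.run rfl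
  have hlen : (Expr.read 1 (.var 1)).eval (writeAllocation.run s) = I.k * I.n := by
    rw [Expr.eval, Expr.eval, hE.v1, hE.a1 _ (by omega)]
    by_cases h0 : I.k = 0
    · simp [h0]
    · rw [hn h0]
  rw [hlen]
  refine Profile.Allocation.encode_eq _ fun i v => ?_
  have hn := hn (by have := i.2; omega)
  subst hn
  have key := fill_spec (a := 0) (τ := 1) (b := 2) (s := s)
    (fun i j => if f i = j then 1 else 0) (by simp) (by simp) (by simp) h.env.min1 h.env.min2
    (fun i hi => h.env.a1 i (by omega)) (e := .sub (.const 1) (.add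
      (.sub (.read 10 (.add (.var 8) (.const 1))) (.add (.var 9) (.const 1)))
      (.sub (.add (.var 9) (.const 1)) (.read 10 (.add (.var 8) (.const 1))))))
    (fun i j t hi hj h8 h9 hf => by
      simp only [Expr.eval, h8, h9, hf.arr 10 rfl, hs i hi]
      split_ifs <;> omega)
  rw [writeAllocation, key i i.2 v v.2]
  simp [Profile.ofColumns]

/-- `1` if the threshold in the input is at least variable `x`, and `0` otherwise. -/
def verdict (x : ℕ) : Expr :=
  .sub (.sub (.const 1) (.read 0 (.const 0))) (.sub (.var x) (.read 0 (.const 1)))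

/-- For `d < 0` the sign bit makes the minuend 0; otherwise the value is `1 - (x - d)`. -/
theorem eval_verdict {x : ℕ} {s : State} {d : ℤ}
    (h0 : s.arr 0 0 = if d < 0 then 1 else 0) (h1 : s.arr 0 1 = d.natAbs) :
    (verdict x).eval s = if (s.var x : ℤ) ≤ d then 1 else 0 := by
  simp only [verdict, Expr.eval, h0, h1]
  split_ifs <;> omega

end RAM.BProg

/-! ### From optimal columns to optimal allocations, and the four problems. -/

namespace Dissat.Profile

open RAM RAM.BProg

variable {I : Profile}

/-- The number `n` is the one the program works with, which may differ from `I.n` if there are no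
agents. -/
theorem exists_columns_cost (hI : I.AllPaths) {n : ℕ} (hn : I.k ≠ 0 → n = I.n)
    (π : I.Allocation) :
    ∃ g, Columns I.k n g ∧ ∀ i : Fin I.k, I.cost i (g i) = I.dissat π i := by
  obtain ⟨g, h1, h2, h3⟩ := exists_columns hI π
  refine ⟨g, ⟨fun i hi => ?_, h2⟩, fun i => by rw [cost_fin, h3]⟩
  rw [hn (by omega)]
  exact h1 i hi

theorem sum_cost (I : Profile) (f : ℕ → ℕ) :
    ∑ i ∈ Finset.range I.k, I.cost i (f i) = ∑ i : Fin I.k, I.cost i (f i) :=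
  Finset.sum_range fun i => I.cost i (f i)

theorem sumDissat_ofColumns (f : ℕ → ℕ) (hinj : Set.InjOn f (Finset.range I.k)) :
    I.sumDissat (I.ofColumns f hinj) = ∑ i ∈ Finset.range I.k, I.cost i (f i) := by
  rw [sum_cost, sumDissat]
  exact Finset.sum_congr rfl fun i _ => by rw [dissat_ofColumns, cost_fin]

/-- Optimal columns give an allocation of minimum total dissatisfaction. -/
theorem sum_cost_le_sumDissat (hI : I.AllPaths) {n : ℕ} (hn : I.k ≠ 0 → n = I.n) {f : ℕ → ℕ}
    (hopt : ∀ g, Columns I.k n g →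
      ∑ i ∈ Finset.range I.k, I.cost i (f i) ≤ ∑ i ∈ Finset.range I.k, I.cost i (g i))
    (π : I.Allocation) : ∑ i ∈ Finset.range I.k, I.cost i (f i) ≤ I.sumDissat π := by
  obtain ⟨g, hg, hc⟩ := exists_columns_cost hI hn π
  refine (hopt g hg).trans_eq ?_
  rw [sum_cost, sumDissat]
  exact Finset.sum_congr rfl fun i _ => hc i

/-- The minimum threshold of columns is a lower bound for every allocation. -/
theorem le_of_dissat_le (hI : I.AllPaths) {n D : ℕ} (hn : I.k ≠ 0 → n = I.n)
    (hopt : ∀ g D', Columns I.k n g → (∀ i < I.k, I.cost i (g i) ≤ D') → D ≤ D')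
    (π : I.Allocation) {d : ℕ} (hd : ∀ i, I.dissat π i ≤ d) : D ≤ d := by
  obtain ⟨g, hg, hc⟩ := exists_columns_cost hI hn π
  exact hopt g d hg fun i hi => (hc ⟨i, hi⟩).trans_le (hd ⟨i, hi⟩)

theorem dissat_ofColumns_le {f : ℕ → ℕ} (hinj : Set.InjOn f (Finset.range I.k)) {D : ℕ}
    (hf : ∀ i < I.k, I.cost i (f i) ≤ D) (i : Fin I.k) :
    I.dissat (I.ofColumns f hinj) i ≤ D := by
  rw [dissat_ofColumns, ← cost_fin]
  exact hf i i.2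

theorem minMax_decidable :
    DecidableInPolyTime encodeWithThreshold (fun x => x.1.AllPaths)
      (fun x => x.1.MinMaxYes x.2) := by
  refine solvable_of_run (setup 2 ;; minMax ;; ite (.var 1)
    (write 0 (.const 0) (verdict 17)) (write 0 (.const 0) (.const 1))) (.const 1) rfl ?_
  rintro ⟨I, d⟩ hI
  obtain ⟨n, hn, hR⟩ := setup_spec hI (o := 2) (w := encodeWithThreshold (I, d))
    (by simp [encodeWithThreshold]; omega) (fun x => by
      rw [encodeWithThreshold, List.getD_append_right _ _ _ _ (by simp)]; simp)
  have hin : ∀ x, ((setup 2).run (State.start (encodeWithThreshold (I, d)))).arr 0 x =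
      (encodeWithThreshold (I, d)).getD x 0 := fun x => by rw [run_arr rfl]; rfl
  have hi0 := hin 0
  have hi1 := hin 1
  simp only [BProg.run]
  generalize (setup 2).run (State.start (encodeWithThreshold (I, d))) = s at hR hi0 hi1 ⊢
  obtain ⟨f, hf, -, hle, hmin⟩ := minMax_spec hR
  have hE : Env _ I.k n 2 (minMax.run s) := hR.env.run rfl
  rw [← run_arr (p := minMax) (s := s) rfl] at hi0 hi1
  generalize minMax.run s = t at hle hmin hE hi0 hi1 ⊢
  have h1 : (Expr.var 1).eval t = I.k := hE.v1
  -- Without agents the answer is yes even for negative `d`, where `verdict` would give `0`.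
  by_cases hk : I.k = 0
  · left
    refine ⟨⟨I.ofColumns f hf.inj, fun i => absurd i.2 (by omega)⟩, ?_⟩
    simp [Expr.eval, hE.v1, hk]
  · rw [if_pos (h1.trans_ne hk), eval_verdict hi0 hi1]
    by_cases hd : (t.var 17 : ℤ) ≤ d
    · left
      refine ⟨⟨I.ofColumns f hf.inj, fun i => le_trans ?_ hd⟩, by simp [Expr.eval, hd]⟩
      exact_mod_cast dissat_ofColumns_le hf.inj hle i
    · right
      refine ⟨?_, by simp [Expr.eval, hd]⟩
      rintro ⟨π, hπ⟩
      -- An agent exists and her dissatisfaction is nonnegative, so `d.toNat` is `d`.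
      have h0 : 0 ≤ d := (Int.natCast_nonneg _).trans (hπ ⟨0, Nat.pos_of_ne_zero hk⟩)
      have := le_of_dissat_le hI hn hmin π (d := d.toNat) fun i => by
        have : (I.dissat π i : ℤ) ≤ d := hπ i
        change I.dissat π i ≤ d.toNat
        omega
      omega

theorem minSum_decidable :
    DecidableInPolyTime encodeWithThreshold (fun x => x.1.AllPaths)
      (fun x => x.1.MinSumYes x.2) := by
  refine solvable_of_run (setup 2 ;; minSum ;; totalExcess (.const 0) ;;
    write 0 (.const 0) (verdict 19)) (.const 1) rfl ?_
  rintro ⟨I, d⟩ hI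
  obtain ⟨n, hn, hR⟩ := setup_spec hI (o := 2) (w := encodeWithThreshold (I, d))
    (by simp [encodeWithThreshold]; omega) (fun x => by
      rw [encodeWithThreshold, List.getD_append_right _ _ _ _ (by simp)]; simp)
  have hin : ∀ x, ((setup 2).run (State.start (encodeWithThreshold (I, d)))).arr 0 x =
      (encodeWithThreshold (I, d)).getD x 0 := fun x => by rw [run_arr rfl]; rfl
  have hi0 := hin 0
  have hi1 := hin 1
  simp only [BProg.run, Expr.eval]
  generalize (setup 2).run (State.start (encodeWithThreshold (I, d))) = s at hR hi0 hi1 ⊢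
  obtain ⟨f, hf, hs, hmin⟩ := minSum_spec hR
  have hR' : Ready _ I.k n 2 I.cost (minSum.run s) := hR.run rfl rfl
  rw [← run_arr (p := minSum) (s := s) rfl] at hi0 hi1
  generalize minSum.run s = t at hs hR' hi0 hi1 ⊢
  have htot := totalExcess_spec hR' hf hs (e := .const 0) (d := 0) fun _ _ => rfl
  rw [← run_arr (p := totalExcess (.const 0)) (s := t) rfl] at hi0 hi1
  generalize (totalExcess (.const 0)).run t = t' at htot hi0 hi1 ⊢
  simp only [Nat.sub_zero] at htot
  rw [eval_verdict hi0 hi1, htot]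
  by_cases hd : ((∑ i ∈ Finset.range I.k, I.cost i (f i) : ℕ) : ℤ) ≤ d
  · left
    exact ⟨⟨I.ofColumns f hf.inj, by rw [sumDissat_ofColumns]; exact hd⟩, by simp only [hd]; simp⟩
  · right
    refine ⟨?_, by simp only [hd]; simp⟩
    rintro ⟨π, hπ⟩
    exact hd (le_trans (by exact_mod_cast sum_cost_le_sumDissat hI hn hmin π) hπ)

theorem minMax_solvable :
    SolvableInPolyTime encode AllPaths (fun I w => ∃ π : I.Allocation, w = π.encode ∧
      ∀ π' : I.Allocation, I.maxDissat π ≤ I.maxDissat π') := by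
  refine solvable_of_run (setup 0 ;; minMax ;; writeAllocation) (.read 1 (.var 1)) rfl fun I hI => ?_
  obtain ⟨n, hn, hR⟩ := setup_spec hI (o := 0) (w := I.encode) (by simp) (by simp)
  simp only [BProg.run]
  generalize (setup 0).run (State.start I.encode) = s at hR ⊢
  obtain ⟨f, hf, hs, hle, hmin⟩ := minMax_spec hR
  refine ⟨I.ofColumns f hf.inj,
    writeAllocation_spec hn (hR.run (p := minMax) rfl rfl) hf.inj hs, fun π' => ?_⟩
  refine Finset.sup_le fun i _ => (dissat_ofColumns_le hf.inj hle i).trans ?_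
  exact le_of_dissat_le hI hn hmin π' fun i => Finset.le_sup (f := I.dissat π') (Finset.mem_univ i)

theorem minSum_solvable :
    SolvableInPolyTime encode AllPaths (fun I w => ∃ π : I.Allocation, w = π.encode ∧
      ∀ π' : I.Allocation, I.sumDissat π ≤ I.sumDissat π') := by
  refine solvable_of_run (setup 0 ;; minSum ;; writeAllocation) (.read 1 (.var 1)) rfl fun I hI => ?_
  obtain ⟨n, hn, hR⟩ := setup_spec hI (o := 0) (w := I.encode) (by simp) (by simp)
  simp only [BProg.run]
  generalize (setup 0).run (State.start I.encode) = s at hR ⊢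
  obtain ⟨f, hf, hs, hmin⟩ := minSum_spec hR
  refine ⟨I.ofColumns f hf.inj,
    writeAllocation_spec hn (hR.run (p := minSum) rfl rfl) hf.inj hs, fun π' => ?_⟩
  rw [sumDissat_ofColumns]
  exact sum_cost_le_sumDissat hI hn hmin π'

end Dissat.Profile

theorem mainTheorem7 :
    -- the decision problems Min-Max and Min-Sum Dissatisfaction
    RAM.DecidableInPolyTime Dissat.Profile.encodeWithThreshold
      (fun x => x.1.AllPaths) (fun x => x.1.MinMaxYes x.2) ∧
    RAM.DecidableInPolyTime Dissat.Profile.encodeWithThreshold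
      (fun x => x.1.AllPaths) (fun x => x.1.MinSumYes x.2) ∧
    -- the optimization problems: find an allocation of minimum maximum, respectively minimum
    -- total, dissatisfaction
    RAM.SolvableInPolyTime Dissat.Profile.encode Dissat.Profile.AllPaths
      (fun I w => ∃ π : I.Allocation, w = π.encode ∧
        ∀ π' : I.Allocation, I.maxDissat π ≤ I.maxDissat π') ∧
    RAM.SolvableInPolyTime Dissat.Profile.encode Dissat.Profile.AllPaths
      (fun I w => ∃ π : I.Allocation, w = π.encode ∧
        ∀ π' : I.Allocation, I.sumDissat π ≤ I.sumDissat π') := by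
  exact ⟨Dissat.Profile.minMax_decidable, Dissat.Profile.minSum_decidable,
    Dissat.Profile.minMax_solvable, Dissat.Profile.minSum_solvable⟩
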